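/- Let $n\in\mathbb N$, $\mathbb T^n=[0,1)^n$, and for $k,l\in\mathbb Z^n$ let $T^t_{(k,l)}$ be the twisted translation on $L^2(\mathbb R^{2n})$, $$T^t_{(k,l)}f(x,y)=e^{\pi i(x\cdot l-y\cdot k)}f(x-k,y-l).$$ For $f\in L^2(\mathbb R^{2n})$ let $K_f\in L^2(\mathbb R^{2n})$ be the kernel of its Weyl transform, that is, the continuous extension to $L^2$ of $K_f(\xi,\eta)=\int_{\mathbb R^n}f(x,\eta-\xi)e^{\pi i x\cdot(\xi+\eta)}\,dx$, $f\in L^1\cap L^2$. Let $$Z_Wf(\xi,\xi',\eta)=\sum_{m\in\mathbb Z^n}K_f(m+\xi,\eta)e^{-2\pi i m\cdot\xi'}$$ with convergence in $L^2(\mathbb T^n\times\mathbb T^n\times\mathbb R^n)$, and let $\mathcal Jf(\xi,\xi')=Z_Wf(\xi,\xi',\cdot)\in L^2(\mathbb R^n)$ for a.e. $(\xi,\xi')\in\mathbb T^n\times\mathbb T^n$. Let $\mathcal A=\{\varphi_s\}_{s\in\mathbb Z}\subset L^2(\mathbb R^{2n})$ and $E^t(\mathcal A)=\{T^t_{(k,l)}\varphi_s:k,l\in\mathbb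 Z^n,\ s\in\mathbb Z\}$, and let $V=V^t(\mathcal A)$ be the closed linear span of $E^t(\mathcal A)$. Let $J(\xi,\xi')$ be the range function of $V$, that is, the closed linear span in $L^2(\mathbb R^n)$ of the vectors $\mathcal Jf(\xi,\xi')$, where $f$ runs through a countable dense subset of $V$, and let $P(\xi,\xi')$ be the orthogonal projection onto $J(\xi,\xi')$. A range operator on $J$ is a family of bounded operators $R(\xi,\xi'):J(\xi,\xi')\to L^2(\mathbb R^n)$; it is measurable if $(\xi,\xi')\mapsto\langle R(\xi,\xi')P(\xi,\xi')a,b\rangle$ is Lebesgue measurable for all $a,b\in L^2(\mathbb R^n)$; and it is associated with a bounded operator $U$ on $L^2(\mathbb R^{2n})$ if for every $f\in V$, for a.e. $(\xi,\xi')$, $\mathcal Jf(\xi,\xi')\in J(\xi,\xi')$ and $\mathcal J(Uf)(\xi,\xi')=R(\xi,\xi')\bigl(\mathcal Jf(\xi,\xi')\bigr)$. **Theorem.** Suppose that $E^t(\mathcal A)$ is a Bessel sequence: for some $B>0$, $\sum_{k,l,s}|\langle f,T^t_{(k,l)}\varphi_s\rangle|^2\le B\|f\|^2$ for all $f\in L^2(\mathbb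 R^{2n})$. Then: 1. The frame operator $Sf=\sum_{k,l,s}\langle f,T^t_{(k,l)}\varphi_s\rangle T^t_{(k,l)}\varphi_s$ is a well-defined bounded operator on $L^2(\mathbb R^{2n})$ (the series converges unconditionally) with values in $V$, and it is twisted shift preserving: $ST^t_{(k,l)}=T^t_{(k,l)}S$ for all $k,l\in\mathbb Z^n$. 2. For a.e. $(\xi,\xi')\in\mathbb T^n\times\mathbb T^n$ the map $H(\xi,\xi'):\ell^2(\mathbb Z)\to L^2(\mathbb R^n)$, $(c_s)\mapsto\sum_s c_s\mathcal J\varphi_s(\xi,\xi')$, is a well-defined bounded operator. Let $\widetilde G(\xi,\xi')=H(\xi,\xi')H(\xi,\xi')^*$ be the dual Gramian of $\{\mathcal J\varphi_s(\xi,\xi'):s\in\mathbb Z\}$ (put $\widetilde G=0$ on the exceptional null set). Then for every $f\in L^2(\mathbb R^{2n})$, $$\mathcal J(Sf)(\xi,\xi')=\widetilde G(\xi,\xi')\bigl(\mathcal Jf(\xi,\xi')\bigr)\quad\text{for a.e. }(\xi,\xi').$$ 3. The range operator of $S$ is $\widetilde G$: the restriction of $\widetilde G(\xi,\xi')$ to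 $J(\xi,\xi')$ is a measurable range operator on $J$ associated with $S$, and every range operator on $J$ associated with $S$ agrees with it for a.e. $(\xi,\xi')$. -/

import Mathlib

noncomputable section

namespace TwistedShift

open MeasureTheory FourierTransform
open scoped ENNReal ContDiff SchwartzMap

/-- `ℝⁿ` with its Euclidean structure and Lebesgue measure. -/
abbrev Rn (n : ℕ) := EuclideanSpace ℝ (Fin n)

/-! ### The kernel of the Weyl transform -/

theorem eLpNorm_two_sq {α : Type*} [MeasurableSpace α] (μ : Measure α) (f : α → ℂ) :
    eLpNorm f 2 μ ^ 2 = ∫⁻ a, ‖f a‖ₑ ^ 2 ∂μ := by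
  have := eLpNorm_nnreal_pow_eq_lintegral (μ := μ) (f := f) (p := 2) (by norm_num)
  simpa using this

/-- Plancherel on `L¹ ∩ L²`, for the inverse Fourier integral. -/
theorem eLpNorm_fourierInv {n : ℕ} {g : Rn n → ℂ} (h1 : Integrable g) (h2 : MemLp g 2) :
    eLpNorm (𝓕⁻ g) 2 = eLpNorm g 2 := by
  have hloc : LocallyIntegrable (𝓕⁻ g) := by
    apply Continuous.locallyIntegrable
    exact VectorFourier.fourierIntegral_continuous Real.continuous_fourierChar
      (L := -innerₗ (Rn n)) (by simp; fun_prop) h1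
  have key : 𝓕⁻ g =ᵐ[volume] (𝓕⁻ h2.toLp : Lp ℂ 2 (volume : Measure (Rn n))) := by
    apply ae_eq_of_integral_contDiff_smul_eq hloc
      ((Lp.memLp _).locallyIntegrable (by norm_num))
    intro ψ hψ hc
    have hg₁ : HasCompactSupport (Complex.ofRealCLM ∘ ψ) := hc.comp_left rfl
    have hg₂ : ContDiff ℝ ∞ (Complex.ofRealCLM ∘ ψ) := by fun_prop
    let Ψ : 𝓢(Rn n, ℂ) := hg₁.toSchwartzMap hg₂
    have e1 : ∫ x, ψ x • (𝓕⁻ g) x = ∫ x, (𝓕⁻ (Ψ : Rn n → ℂ)) x • g x := by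
      have := VectorFourier.integral_fourierIntegral_smul_eq_flip (μ := volume) (ν := volume)
        (L := -innerₗ (Rn n)) (f := (Ψ : Rn n → ℂ)) (g := g)
        Real.continuous_fourierChar (by simp; fun_prop) Ψ.integrable h1
      have hf : (-innerₗ (Rn n)).flip = -innerₗ (Rn n) := by
        ext x y; simp [real_inner_comm]
      rw [hf] at this
      exact this.symm
    have e2 : ∫ x, ψ x • (𝓕⁻ h2.toLp : Lp ℂ 2 (volume : Measure (Rn n))) x
        = ∫ x, (𝓕⁻ (Ψ : Rn n → ℂ)) x • g x := by
      have := congrArg (fun T : 𝓢'(Rn n, ℂ) => T Ψ) (Lp.fourierInv_toTemperedDistribution_eq h2.toLp)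
      simp only [TemperedDistribution.fourierInv_apply, Lp.toTemperedDistribution_apply] at this
      rw [SchwartzMap.fourierInv_coe] at this
      refine this.symm.trans (integral_congr_ae ?_)
      filter_upwards [h2.coeFn_toLp] with x hx
      rw [hx]
    rw [e1, e2]
  rw [eLpNorm_congr_ae key, ← Lp.enorm_def, ← eLpNorm_congr_ae h2.coeFn_toLp, ← Lp.enorm_def]
  have : ‖(𝓕⁻ h2.toLp : Lp ℂ 2 (volume : Measure (Rn n)))‖ = ‖h2.toLp‖ :=
    (Lp.fourierTransformₗᵢ (Rn n) ℂ).symm.norm_map _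
  rw [← ofReal_norm, ← ofReal_norm, this]


/-- `L²(ℝⁿ)`. -/
abbrev L2 (n : ℕ) := Lp ℂ 2 (volume : Measure (Rn n))

/-- `L²(ℝ²ⁿ)`, with `ℝ²ⁿ = ℝⁿ × ℝⁿ`. -/
abbrev L2Double (n : ℕ) := Lp ℂ 2 (volume : Measure (Rn n × Rn n))

/-- The kernel `K_f(ξ, η) = ∫ f(x, η - ξ) e^{πi x·(ξ + η)} dx` of the Weyl transform of an integrable
function `f` on `ℝ²ⁿ`. -/
def kernelIntegral {n : ℕ} (f : Rn n × Rn n → ℂ) (q : Rn n × Rn n) : ℂ :=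
  ∫ x, f (x, q.2 - q.1) * Complex.exp (Real.pi * Complex.I * (inner ℝ x (q.1 + q.2) : ℝ))

theorem kernelIntegral_eq {n : ℕ} (f : Rn n × Rn n → ℂ) (q : Rn n × Rn n) :
    kernelIntegral f q = 𝓕⁻ (fun x => f (x, q.2 - q.1)) ((1 / 2 : ℝ) • (q.1 + q.2)) := by
  rw [Real.fourierInv_eq', kernelIntegral]
  congr 1
  ext x
  rw [inner_smul_right, smul_eq_mul, mul_comm]
  congr 2
  push_cast
  ring

theorem stronglyMeasurable_kernelIntegral {n : ℕ} {f : Rn n × Rn n → ℂ}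
    (hf : StronglyMeasurable f) : StronglyMeasurable (kernelIntegral f) := by
  apply StronglyMeasurable.integral_prod_right (f := fun (q : Rn n × Rn n) (x : Rn n) =>
    f (x, q.2 - q.1) * Complex.exp (Real.pi * Complex.I * (inner ℝ x (q.1 + q.2) : ℝ)))
  apply StronglyMeasurable.mul
  · exact hf.comp_measurable (by fun_prop)
  · apply Continuous.stronglyMeasurable
    fun_prop

theorem lintegral_kernelIntegral {n : ℕ} {f : Rn n × Rn n → ℂ}
    (hf : StronglyMeasurable f) (h1 : Integrable f) (h2 : MemLp f 2) :
    ∫⁻ q, ‖kernelIntegral f q‖ₑ ^ 2 = ∫⁻ z, ‖f z‖ₑ ^ 2 := by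
  have hm : Measurable fun q => ‖kernelIntegral f q‖ₑ ^ 2 :=
    (stronglyMeasurable_kernelIntegral hf).measurable.enorm.pow_const 2
  have hm' : Measurable fun z => ‖f z‖ₑ ^ 2 := hf.measurable.enorm.pow_const 2
  have hfin : ∫⁻ z, ‖f z‖ₑ ^ 2 < ⊤ := by
    rw [← eLpNorm_two_sq]; exact ENNReal.pow_lt_top h2.2
  rw [Measure.volume_eq_prod] at h1 hfin ⊢
  have s1 : ∀ᵐ y : Rn n, Integrable (fun x => f (x, y)) := h1.prod_left_ae
  have s2 : ∀ᵐ y : Rn n, ∫⁻ x, ‖f (x, y)‖ₑ ^ 2 < ⊤ := by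
    rw [lintegral_prod_symm _ hm'.aemeasurable] at hfin
    exact ae_lt_top hm'.lintegral_prod_left' hfin.ne
  calc ∫⁻ q, ‖kernelIntegral f q‖ₑ ^ 2 ∂(volume.prod volume)
      = ∫⁻ ξ, ∫⁻ η, ‖kernelIntegral f (ξ, η)‖ₑ ^ 2 := lintegral_prod _ hm.aemeasurable
    _ = ∫⁻ ξ, ∫⁻ y, ‖kernelIntegral f (ξ, y + ξ)‖ₑ ^ 2 := by
        congr 1; ext ξ
        exact (lintegral_add_right_eq_self (fun η => ‖kernelIntegral f (ξ, η)‖ₑ ^ 2) ξ).symm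
    _ = ∫⁻ y, ∫⁻ ξ, ‖kernelIntegral f (ξ, y + ξ)‖ₑ ^ 2 := by
        rw [lintegral_lintegral_swap]
        exact (hm.comp (g := fun q => ‖kernelIntegral f q‖ₑ ^ 2) (f := fun p : Rn n × Rn n => (p.1, p.2 + p.1)) (by fun_prop)).aemeasurable
    _ = ∫⁻ y, ∫⁻ x, ‖f (x, y)‖ₑ ^ 2 := by
        apply lintegral_congr_ae
        filter_upwards [s1, s2] with y hy1 hy2
        have hy3 : MemLp (fun x => f (x, y)) 2 := by
          refine ⟨hy1.1, ?_⟩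
          rw [← eLpNorm_two_sq] at hy2
          by_contra h
          simp only [not_lt, top_le_iff] at h
          simp [h] at hy2
        rw [← eLpNorm_two_sq volume (fun x => f (x, y)), ← eLpNorm_fourierInv hy1 hy3,
          eLpNorm_two_sq, ← lintegral_add_right_eq_self
            (fun w => ‖𝓕⁻ (fun x => f (x, y)) w‖ₑ ^ 2) ((1 / 2 : ℝ) • y)]
        congr 1; ext ξ
        rw [kernelIntegral_eq]
        have hξ : (1 / 2 : ℝ) • (ξ + (y + ξ)) = ξ + (1 / 2 : ℝ) • y := by module
        simp only [add_sub_cancel_right, hξ]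
    _ = ∫⁻ z, ‖f z‖ₑ ^ 2 ∂(volume.prod volume) := (lintegral_prod_symm _ hm'.aemeasurable).symm

theorem eLpNorm_kernelIntegral {n : ℕ} (f : L2Double n) (h1 : Integrable f) :
    eLpNorm (kernelIntegral f) 2 = eLpNorm f 2 := by
  have h := lintegral_kernelIntegral (Lp.stronglyMeasurable f) h1 (Lp.memLp f)
  rw [← eLpNorm_two_sq, ← eLpNorm_two_sq] at h
  exact (ENNReal.pow_right_strictMono two_ne_zero).injective h

theorem memLp_kernelIntegral {n : ℕ} (f : L2Double n) (h1 : Integrable f) :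
    MemLp (kernelIntegral f) 2 :=
  ⟨(stronglyMeasurable_kernelIntegral (Lp.stronglyMeasurable f)).aestronglyMeasurable, by
    rw [eLpNorm_kernelIntegral f h1]; exact (Lp.memLp f).2⟩

theorem quasiMeasurePreserving_sub_snd {n : ℕ} :
    Measure.QuasiMeasurePreserving (fun q : Rn n × Rn n => q.2 - q.1) volume volume :=
  (quasiMeasurePreserving_sub volume volume).comp
    Measure.measurePreserving_swap.quasiMeasurePreserving

theorem ae_slice {n : ℕ} {P : Rn n × Rn n → Prop} (h : ∀ᵐ z, P z) :
    ∀ᵐ q : Rn n × Rn n, ∀ᵐ x : Rn n, P (x, q.2 - q.1) := by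
  have hs : ∀ᵐ z : Rn n × Rn n, P z.swap := by
    rw [Measure.volume_eq_prod] at h ⊢
    exact Measure.measurePreserving_swap.quasiMeasurePreserving.ae h
  rw [Measure.volume_eq_prod] at hs
  have h' : ∀ᵐ y : Rn n, ∀ᵐ x : Rn n, P (x, y) := Measure.ae_ae_of_ae_prod hs
  exact quasiMeasurePreserving_sub_snd.ae h'

/-- `L¹ ∩ L²`, as a subspace of `L²(ℝ²ⁿ)`. -/
def integrableSubmodule (n : ℕ) : Submodule ℂ (L2Double n) where
  carrier := {f | Integrable (fun z => f z) volume}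
  add_mem' {f g} hf hg := by
    have hf' : Integrable (fun z => f z) volume := hf
    have hg' : Integrable (fun z => g z) volume := hg
    exact (hf'.add hg').congr (Lp.coeFn_add f g).symm
  zero_mem' := (integrable_zero _ _ _).congr (Lp.coeFn_zero _ _ _).symm
  smul_mem' c f hf := by
    have hf' : Integrable (fun z => f z) volume := hf
    exact (hf'.smul c).congr (Lp.coeFn_smul c f).symm

theorem integrable_kernel_integrand {n : ℕ} {f : Rn n × Rn n → ℂ} {q : Rn n × Rn n}
    (h : Integrable fun x => f (x, q.2 - q.1)) :
    Integrable fun x => f (x, q.2 - q.1) *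
      Complex.exp (Real.pi * Complex.I * (inner ℝ x (q.1 + q.2) : ℝ)) := by
  refine h.mul_bdd (c := 1) (Continuous.aestronglyMeasurable (by fun_prop))
    (Filter.Eventually.of_forall fun x => ?_)
  rw [mul_right_comm, ← Complex.ofReal_mul, Complex.norm_exp_ofReal_mul_I]

/-- The map `f ↦ K_f` from `L¹ ∩ L²` to `L²(ℝ²ⁿ)`. -/
def kernelOnIntegrable (n : ℕ) : integrableSubmodule n →ₗ[ℂ] L2Double n where
  toFun f := (memLp_kernelIntegral f.1 f.2).toLp
  map_add' f g := by
    rw [← MemLp.toLp_add, MemLp.toLp_eq_toLp_iff]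
    have key := ae_slice (Lp.coeFn_add f.1 g.1)
    have i1 : Integrable f.1 (volume.prod volume) := f.2
    have i2 : Integrable g.1 (volume.prod volume) := g.2
    have j1 := (quasiMeasurePreserving_sub_snd (n := n)).ae i1.prod_left_ae
    have j2 := (quasiMeasurePreserving_sub_snd (n := n)).ae i2.prod_left_ae
    filter_upwards [key, j1, j2] with q hq h1 h2
    rw [Pi.add_apply, kernelIntegral, kernelIntegral, kernelIntegral, ← integral_add
      (integrable_kernel_integrand h1) (integrable_kernel_integrand h2)]
    apply integral_congr_ae
    filter_upwards [hq] with x hx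
    simp only [Submodule.coe_add, hx, Pi.add_apply, add_mul]
  map_smul' c f := by
    rw [RingHom.id_apply, ← MemLp.toLp_const_smul, MemLp.toLp_eq_toLp_iff]
    filter_upwards [ae_slice (Lp.coeFn_smul c f.1)] with q hq
    rw [Pi.smul_apply, kernelIntegral, kernelIntegral, ← integral_smul]
    apply integral_congr_ae
    filter_upwards [hq] with x hx
    simp only [Submodule.coe_smul, hx, Pi.smul_apply, smul_eq_mul, mul_assoc]

/-- The kernel `K_f` of the Weyl transform of `f ∈ L²(ℝ²ⁿ)`: the extension by continuity of the
isometry `kernelOnIntegrable` from the dense subspace `L¹ ∩ L²`. -/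
def weylKernel (n : ℕ) : L2Double n →L[ℂ] L2Double n :=
  (kernelOnIntegrable n).extendOfNorm (integrableSubmodule n).subtype

theorem norm_kernelOnIntegrable {n : ℕ} (f : integrableSubmodule n) :
    ‖kernelOnIntegrable n f‖ = ‖(f : L2Double n)‖ := by
  change ‖(memLp_kernelIntegral f.1 f.2).toLp‖ = _
  rw [Lp.norm_toLp, eLpNorm_kernelIntegral f.1 f.2, Lp.norm_def]

theorem denseRange_integrable (n : ℕ) : DenseRange (integrableSubmodule n).subtype := by
  have hH : (volume : Measure (Rn n × Rn n)).IsAddHaarMeasure := by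
    rw [Measure.volume_eq_prod]; infer_instance
  refine (SchwartzMap.denseRange_toLpCLM (E := Rn n × Rn n) (F := ℂ) (p := 2) (μ := volume)
    (by norm_num)).mono ?_
  rintro _ ⟨ψ, rfl⟩
  exact ⟨⟨ψ.toLp 2, ψ.integrable.congr (ψ.coeFn_toLp 2 volume).symm⟩, rfl⟩

theorem weylKernel_ae_eq {n : ℕ} (f : L2Double n) (hf : Integrable f) :
    weylKernel n f =ᵐ[volume] kernelIntegral f := by
  have : weylKernel n f = kernelOnIntegrable n ⟨f, hf⟩ :=
    LinearMap.extendOfNorm_eq (denseRange_integrable n)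
      ⟨1, fun g => by rw [one_mul]; exact (norm_kernelOnIntegrable g).le⟩ ⟨f, hf⟩
  rw [this]
  exact (memLp_kernelIntegral f hf).coeFn_toLp


/-! ### Twisted translations -/

/-- An integer vector as a point of `ℝⁿ`. -/
def intVec {n : ℕ} (k : Fin n → ℤ) : Rn n := WithLp.toLp 2 fun i => (k i : ℝ)

/-- The function `(x, y) ↦ e^{πi(x·l - y·k)} f(x - k, y - l)`. -/
def twistedFun {n : ℕ} (k l : Fin n → ℤ) (f : Rn n × Rn n → ℂ) (z : Rn n × Rn n) : ℂ :=
  Complex.exp ((Real.pi * (inner ℝ z.1 (intVec l) - inner ℝ z.2 (intVec k)) : ℝ) * Complex.I) *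
    f (z.1 - intVec k, z.2 - intVec l)

theorem memLp_twistedFun {n : ℕ} (k l : Fin n → ℤ) (f : L2Double n) :
    MemLp (twistedFun k l f) 2 := by
  have hmp : MeasurePreserving (fun z : Rn n × Rn n => (z.1 - intVec k, z.2 - intVec l)) :=
    (measurePreserving_sub_right volume (intVec k)).prod
      (measurePreserving_sub_right volume (intVec l))
  have h1 : MemLp (fun z : Rn n × Rn n => f (z.1 - intVec k, z.2 - intVec l)) 2 :=
    (Lp.memLp f).comp_measurePreserving hmp
  refine h1.of_le ?_ (Filter.Eventually.of_forall fun z => ?_)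
  · exact (Continuous.aestronglyMeasurable (by fun_prop)).mul h1.1
  · rw [twistedFun, norm_mul, Complex.norm_exp_ofReal_mul_I, one_mul]

/-- The twisted translation `T^t_{(k,l)}` on `L²(ℝ²ⁿ)`. -/
def twistedTranslation {n : ℕ} (k l : Fin n → ℤ) (f : L2Double n) : L2Double n :=
  (memLp_twistedFun k l f).toLp

/-- The system `E^t(𝒜) = {T^t_{(k,l)} φ_s}`, indexed by `(k, l, s)`. -/
def twistedSystem {n : ℕ} (φ : ℤ → L2Double n)
    (i : (Fin n → ℤ) × (Fin n → ℤ) × ℤ) : L2Double n :=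
  twistedTranslation i.1 i.2.1 (φ i.2.2)

/-- `V^t(𝒜)`, the closed linear span of `E^t(𝒜)`. -/
def twistedSpan {n : ℕ} (φ : ℤ → L2Double n) : Submodule ℂ (L2Double n) :=
  (Submodule.span ℂ (Set.range (twistedSystem φ))).topologicalClosure

/-- Bounded operators on `L²(ℝ²ⁿ)` that commute with all twisted translations. -/
def IsTwistedShiftPreserving {n : ℕ} (U : L2Double n →L[ℂ] L2Double n) : Prop :=
  ∀ (k l : Fin n → ℤ) (f : L2Double n),
    U (twistedTranslation k l f) = twistedTranslation k l (U f)

/-! ### Bessel sequences and frame operators -/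

/-- `g` is a Bessel sequence in `H`: `∑ |⟨f, g i⟩|² ≤ B ‖f‖²` for all `f ∈ H`. -/
def IsBesselSequence {ι H : Type*} [NormedAddCommGroup H] [InnerProductSpace ℂ H]
    (g : ι → H) : Prop :=
  ∃ B : ℝ, 0 < B ∧ ∀ f : H, Summable (fun i => ‖inner ℂ (g i) f‖ ^ 2) ∧
    ∑' i, ‖inner ℂ (g i) f‖ ^ 2 ≤ B * ‖f‖ ^ 2

/-- `S` is the frame operator of `g`: `S f = ∑ ⟨f, g i⟩ g i`, with unconditional convergence.
Mathlib's inner product is linear in its second argument. -/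
def IsFrameOperator {ι H : Type*} [NormedAddCommGroup H] [InnerProductSpace ℂ H]
    (g : ι → H) (S : H →L[ℂ] H) : Prop :=
  ∀ f : H, HasSum (fun i => inner ℂ (g i) f • g i) (S f)

/-! ### The Weyl–Zak transform and the map `𝒥` -/

/-- The fundamental domain `[0,1)ⁿ` that represents the torus `𝕋ⁿ`. -/
def cube (n : ℕ) : Set (Rn n) := {ξ | ∀ i, ξ i ∈ Set.Ico (0 : ℝ) 1}

/-- Lebesgue measure on `𝕋ⁿ`. -/
def torusMeasure (n : ℕ) : Measure (Rn n) := volume.restrict (cube n)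

instance isProbabilityMeasure_torusMeasure (n : ℕ) : IsProbabilityMeasure (torusMeasure n) := by
  constructor
  have h : cube n = WithLp.ofLp ⁻¹' (Set.univ.pi fun _ : Fin n => Set.Ico (0 : ℝ) 1) := by
    ext ξ; simp [cube]
  rw [torusMeasure, Measure.restrict_apply_univ, h,
    (PiLp.volume_preserving_ofLp (Fin n)).measure_preimage
      (MeasurableSet.univ_pi fun _ => measurableSet_Ico).nullMeasurableSet,
    Real.volume_pi_Ico]
  simp

/-- Lebesgue measure on `𝕋ⁿ × 𝕋ⁿ`. -/
abbrev torusMeasure₂ (n : ℕ) : Measure (Rn n × Rn n) := (torusMeasure n).prod (torusMeasure n)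

/-- `L²(𝕋ⁿ × 𝕋ⁿ × ℝⁿ)`. -/
abbrev ZakSpace (n : ℕ) :=
  Lp ℂ 2 ((torusMeasure₂ n).prod (volume : Measure (Rn n)))

/-- The function `(ξ, ξ', η) ↦ K(m + ξ, η) e^{-2πi m·ξ'}`. -/
def zakTermFun {n : ℕ} (m : Fin n → ℤ) (K : Rn n × Rn n → ℂ) (w : (Rn n × Rn n) × Rn n) : ℂ :=
  K (intVec m + w.1.1, w.2) *
    Complex.exp ((-2 * Real.pi * inner ℝ (intVec m) w.1.2 : ℝ) * Complex.I)

theorem memLp_zakTermFun {n : ℕ} (m : Fin n → ℤ) (K : L2Double n) :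
    MemLp (zakTermFun m K) 2 ((torusMeasure₂ n).prod (volume : Measure (Rn n))) := by
  have hmp : MeasurePreserving (fun z : Rn n × Rn n => (intVec m + z.1, z.2)) :=
    (measurePreserving_add_left volume (intVec m)).prod (MeasurePreserving.id volume)
  have h0 : MemLp (fun z : Rn n × Rn n => K (intVec m + z.1, z.2)) 2 :=
    (Lp.memLp K).comp_measurePreserving hmp
  have h1 : MemLp (fun z : Rn n × Rn n => K (intVec m + z.1, z.2)) 2
      ((torusMeasure n).prod volume) := by
    refine h0.mono_measure ?_
    rw [Measure.volume_eq_prod]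
    exact Measure.prod_mono Measure.restrict_le_self le_rfl
  have hp : MeasurePreserving (fun w : (Rn n × Rn n) × Rn n => (w.1.1, w.2))
      ((torusMeasure₂ n).prod volume) ((torusMeasure n).prod volume) :=
    measurePreserving_fst.prod (MeasurePreserving.id volume)
  have h2 := h1.comp_measurePreserving hp
  refine h2.of_le ?_ (Filter.Eventually.of_forall fun w => ?_)
  · exact h2.1.mul (Continuous.aestronglyMeasurable (by fun_prop))
  · rw [zakTermFun, norm_mul, Complex.norm_exp_ofReal_mul_I, mul_one]
    rfl

/-- The Weyl–Zak transform `Z_W f(ξ, ξ', η) = ∑_m K_f(m + ξ, η) e^{-2πi m·ξ'}`, the sum being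
taken in `L²(𝕋ⁿ × 𝕋ⁿ × ℝⁿ)`. -/
def weylZak {n : ℕ} (f : L2Double n) : ZakSpace n :=
  ∑' m : Fin n → ℤ, (memLp_zakTermFun m (weylKernel n f)).toLp

open Classical in
/-- The fibre `𝒥 f(ξ, ξ') = Z_W f(ξ, ξ', ·) ∈ L²(ℝⁿ)`, which is defined for almost every
`p = (ξ, ξ')`. -/
def fiber {n : ℕ} (f : L2Double n) (p : Rn n × Rn n) : L2 n :=
  if h : MemLp (fun η => weylZak f (p, η)) 2 volume then h.toLp else 0

instance separableSpace_submodule {n : ℕ} (V : Submodule ℂ (L2Double n)) :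
    TopologicalSpace.SeparableSpace V := by
  have : Fact ((2 : ℝ≥0∞) ≠ ⊤) := ⟨by norm_num⟩
  have : MeasurableSpace.CountablyGenerated (Rn n × Rn n) := inferInstance
  have : SFinite (volume : Measure (Rn n × Rn n)) := inferInstance
  have : MeasureTheory.IsSeparable (volume : Measure (Rn n × Rn n)) := inferInstance
  have : SecondCountableTopology (L2Double n) := Lp.SecondCountableTopology
  infer_instance

/-! ### Range functions and range operators -/

/-- The range function `J(ξ, ξ')` of a closed subspace `V` of `L²(ℝ²ⁿ)`: the closed span of the
fibres of the elements of `V`. Since each `𝒥 f` is determined only up to a null set, `f` runs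
through a countable dense subset of `V`; any other choice of it changes `J` on a null set only. -/
def rangeFunction {n : ℕ} (V : Submodule ℂ (L2Double n)) (p : Rn n × Rn n) :
    Submodule ℂ (L2 n) :=
  (Submodule.span ℂ (Set.range fun i : ℕ =>
    fiber (TopologicalSpace.denseSeq V i : L2Double n) p)).topologicalClosure

instance completeSpace_rangeFunction {n : ℕ} (V : Submodule ℂ (L2Double n))
    (p : Rn n × Rn n) : CompleteSpace (rangeFunction V p) :=
  (Submodule.isClosed_topologicalClosure _).completeSpace_coe

/-- A range operator on the range function of `V`. -/
abbrev RangeOperator {n : ℕ} (V : Submodule ℂ (L2Double n)) :=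
  (p : Rn n × Rn n) → rangeFunction V p →L[ℂ] L2 n

/-- `R` is measurable: `p ↦ ⟨R(p) P(p) a, b⟩` is measurable for all `a, b`, where `P(p)` is the
orthogonal projection onto `J(p)`. -/
def RangeOperator.IsMeasurable {n : ℕ} {V : Submodule ℂ (L2Double n)}
    (R : RangeOperator V) : Prop :=
  ∀ a b : L2 n,
    AEMeasurable (fun p => inner ℂ b (R p ((rangeFunction V p).orthogonalProjectionOnto a)))
      (torusMeasure₂ n)

/-- `R` is a range operator of `U`: for every `f ∈ V`, `(𝒥 ∘ U) f(p) = R(p)(𝒥 f(p))` for almost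
every `p`. -/
def RangeOperator.IsAssociatedTo {n : ℕ} {V : Submodule ℂ (L2Double n)}
    (R : RangeOperator V) (U : L2Double n →L[ℂ] L2Double n) : Prop :=
  ∀ f ∈ V, ∀ᵐ p ∂(torusMeasure₂ n), ∃ h : fiber f p ∈ rangeFunction V p,
    fiber (U f) p = R p ⟨fiber f p, h⟩

/-! ### The dual Gramian -/

/-- `H` is the bounded operator `ℓ²(ℤ) → F`, `(c_s) ↦ ∑_s c_s v_s`. -/
def IsSynthesisOperator {F : Type*} [NormedAddCommGroup F] [InnerProductSpace ℂ F]
    (v : ℤ → F) (H : lp (fun _ : ℤ => ℂ) 2 →L[ℂ] F) : Prop :=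
  ∀ c : lp (fun _ : ℤ => ℂ) 2, HasSum (fun s => c s • v s) (H c)

open Classical in
/-- The operator `H`, with value `0` if `c ↦ ∑_s c_s v_s` is not a bounded operator. -/
def synthesisOperator {F : Type*} [NormedAddCommGroup F] [InnerProductSpace ℂ F]
    (v : ℤ → F) : lp (fun _ : ℤ => ℂ) 2 →L[ℂ] F :=
  if h : ∃ H, IsSynthesisOperator v H then h.choose else 0

/-- The dual Gramian `H H*` of the system `v`. -/
def dualGramian {F : Type*} [NormedAddCommGroup F] [InnerProductSpace ℂ F] [CompleteSpace F]
    (v : ℤ → F) : F →L[ℂ] F :=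
  synthesisOperator v ∘L (synthesisOperator v).adjoint

end TwistedShift

end

open MeasureTheory TwistedShift

noncomputable section

namespace TwistedShift

open MeasureTheory
open scoped ENNReal ComplexConjugate

/-! The Weyl–Zak transform is a linear isometry into L²(𝕋ⁿ × 𝕋ⁿ × ℝⁿ), viewed as square integrable
fields of vectors of L²(ℝⁿ). It turns each twisted translation into multiplication by the scalar
e^{πi k·l} e^{2πi(k·ξ + l·ξ')} (`weylZak_twistedTranslation`). So the inner product of f with
T^t_{(k,l)} φ_s is, up to a unimodular constant and conjugation, a Fourier coefficient of p ↦
⟨𝒥φ_s(p), 𝒥f(p)⟩, and Parseval trades the sum over (k, l) for an integral over the torus.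

Applied to the Bessel inequality, with test fields supported on an arbitrary set E and pointing in a
fixed direction a, this localises the bound: almost every fibre system is Bessel with the same B
(`ae_bessel_fiber`). Hence H(p) is the adjoint of a bounded analysis operator. Applied to the series
for S f, it gives ∫ ⟨G̃(p) 𝒥f(p), F(p)⟩ dp = ⟨Z_W S f, F⟩ for every F
(`inner_weylZak_frameOperator`), and localising again yields the fibre formula
(`fiber_frameOperator`).

The rest is read off the fibres. S commutes with twisted translations because G̃(p) commutes with
scalars. Range operators are unique because countably many fibres span J(p). G̃ P is measurable
because G̃ P = G̃. Only the isometry property of Z_W is used, never its surjectivity. -/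

/-! ### Bessel families in Hilbert spaces -/

section Bessel

variable {ι H : Type*} [NormedAddCommGroup H] [InnerProductSpace ℂ H]

/-- `g` is a Bessel family with bound `B`. -/
def HasBesselBound (g : ι → H) (B : ℝ) : Prop :=
  ∀ f : H, Summable (fun i => ‖inner ℂ (g i) f‖ ^ 2) ∧
    ∑' i, ‖inner ℂ (g i) f‖ ^ 2 ≤ B * ‖f‖ ^ 2

/-- `C` is the analysis operator `f ↦ (⟨g i, f⟩)_i` of the family `g`. -/
def IsAnalysisOperator (g : ι → H) (C : H →L[ℂ] lp (fun _ : ι => ℂ) 2) : Prop :=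
  ∀ f i, C f i = inner ℂ (g i) f

theorem exists_isAnalysisOperator {g : ι → H} {B : ℝ} (hB : 0 ≤ B)
    (hg : HasBesselBound g B) :
    ∃ C, IsAnalysisOperator g C := by
  have hmem (f : H) : Memℓp (fun i => inner ℂ (g i) f) 2 :=
    memℓp_gen (by simpa using (hg f).1)
  let L : H →ₗ[ℂ] lp (fun _ : ι => ℂ) 2 :=
    { toFun := fun f => ⟨fun i => inner ℂ (g i) f, hmem f⟩
      map_add' := fun f f' => by ext i; exact inner_add_right _ _ _
      map_smul' := fun c f => by ext i; exact inner_smul_right _ _ _ }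
  refine ⟨L.mkContinuous (Real.sqrt B) fun f => ?_, fun f i => rfl⟩
  refine le_of_sq_le_sq ?_ (by positivity)
  rw [mul_pow, Real.sq_sqrt hB]
  have h := lp.norm_rpow_eq_tsum (p := 2) (by norm_num) (L f)
  norm_num at h
  rw [h]
  exact (hg f).2

theorem IsAnalysisOperator.norm_sq {g : ι → H} {C : H →L[ℂ] lp (fun _ : ι => ℂ) 2}
    (hC : IsAnalysisOperator g C) (a : H) : HasSum (fun i => ‖inner ℂ (g i) a‖ ^ 2) (‖C a‖ ^ 2) := by
  have h : HasSum (fun i => inner ℂ (C a i) (C a i)) (inner ℂ (C a) (C a)) :=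
    lp.hasSum_inner (𝕜 := ℂ) (C a) (C a)
  rw [inner_self_eq_norm_sq_to_K] at h
  simp only [inner_self_eq_norm_sq_to_K, hC a] at h
  exact_mod_cast Complex.hasSum_re h

variable [CompleteSpace H]

/-- The adjoint sends the i-th unit vector to `g i`, and c is the unconditional ℓ² sum of its
coordinates. This one fact yields both the frame operator C*C and the synthesis operator C*. -/
theorem IsAnalysisOperator.hasSum_adjoint {g : ι → H} {C : H →L[ℂ] lp (fun _ : ι => ℂ) 2}
    (hC : IsAnalysisOperator g C) (c : lp (fun _ : ι => ℂ) 2) :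
    HasSum (fun i => c i • g i) (C.adjoint c) := by
  classical
  have h := (lp.hasSum_single (p := 2) (by norm_num) c).mapL C.adjoint
  convert h using 1
  ext i
  refine ext_inner_right ℂ fun f => ?_
  rw [ContinuousLinearMap.adjoint_inner_left, lp.inner_single_left, hC, inner_smul_left]
  simp [mul_comm]

theorem IsAnalysisOperator.isFrameOperator {g : ι → H} {C : H →L[ℂ] lp (fun _ : ι => ℂ) 2}
    (hC : IsAnalysisOperator g C) : IsFrameOperator g (C.adjoint ∘L C) := fun f => by
  simpa only [hC f, ContinuousLinearMap.comp_apply] using hC.hasSum_adjoint (C f)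

theorem IsAnalysisOperator.isSynthesisOperator {v : ℤ → H}
    {C : H →L[ℂ] lp (fun _ : ℤ => ℂ) 2} (hC : IsAnalysisOperator v C) :
    IsSynthesisOperator v (synthesisOperator v) := by
  have h : ∃ H, IsSynthesisOperator v H := ⟨C.adjoint, hC.hasSum_adjoint⟩
  rw [synthesisOperator, dif_pos h]
  exact h.choose_spec

/-- Existence of C excludes the default value 0, and uniqueness of sums removes the dependence on
choice. -/
theorem IsAnalysisOperator.synthesisOperator_eq {v : ℤ → H}
    {C : H →L[ℂ] lp (fun _ : ℤ => ℂ) 2} (hC : IsAnalysisOperator v C) :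
    synthesisOperator v = C.adjoint :=
  ContinuousLinearMap.ext fun c => (hC.isSynthesisOperator c).unique (hC.hasSum_adjoint c)

/-- Here H = C*, so the pairing is ⟨Ca, Cb⟩ in ℓ². The scalar series it becomes is what
measurability and Parseval are applied to. -/
theorem IsAnalysisOperator.inner_dualGramian {v : ℤ → H}
    {C : H →L[ℂ] lp (fun _ : ℤ => ℂ) 2} (hC : IsAnalysisOperator v C) (a b : H) :
    HasSum (fun s => conj (inner ℂ (v s) a) * inner ℂ (v s) b) (inner ℂ (dualGramian v a) b) := by
  rw [dualGramian, hC.synthesisOperator_eq, ContinuousLinearMap.adjoint_adjoint,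
    ContinuousLinearMap.comp_apply, ContinuousLinearMap.adjoint_inner_left]
  have h : HasSum (fun s => inner ℂ (C a s) (C b s)) (inner ℂ (C a) (C b)) :=
    lp.hasSum_inner (𝕜 := ℂ) (C a) (C b)
  simpa only [hC a, hC b, RCLike.inner_apply, mul_comm] using h

end Bessel

/-! ### Orthogonal series -/

section Orthogonal

variable {ι H : Type*} [NormedAddCommGroup H] [InnerProductSpace ℂ H] [CompleteSpace H]

theorem summable_of_pairwise_inner_eq_zero {v : ι → H}
    (hv : Pairwise fun i j => inner ℂ (v i) (v j) = 0) (hs : Summable fun i => ‖v i‖ ^ 2) :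
    Summable v := by
  have hO : OrthogonalFamily ℂ (fun i => (ℂ ∙ v i : Submodule ℂ H))
      fun i => (ℂ ∙ v i : Submodule ℂ H).subtypeₗᵢ := by
    refine OrthogonalFamily.of_pairwise fun i j hij => ?_
    refine Submodule.isOrtho_span.2 ?_
    rintro _ rfl _ rfl
    exact hv hij
  exact (hO.summable_iff_norm_sq_summable
    fun i => ⟨v i, Submodule.mem_span_singleton_self (v i)⟩).2 hs

theorem norm_tsum_sq_of_pairwise_inner_eq_zero {v : ι → H}
    (hv : Pairwise fun i j => inner ℂ (v i) (v j) = 0) (hs : Summable fun i => ‖v i‖ ^ 2) :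
    ‖∑' i, v i‖ ^ 2 = ∑' i, ‖v i‖ ^ 2 := by
  have h := (summable_of_pairwise_inner_eq_zero hv hs).hasSum
  have h1 : HasSum (fun j => inner ℂ (∑' i, v i) (v j)) (inner ℂ (∑' i, v i) (∑' i, v i)) :=
    h.mapL (innerSL ℂ (∑' i, v i))
  have h2 (j : ι) : inner ℂ (∑' i, v i) (v j) = ((‖v j‖ ^ 2 : ℝ) : ℂ) := by
    have h3 : HasSum (fun i => inner ℂ (v j) (v i)) (inner ℂ (v j) (∑' i, v i)) :=
      h.mapL (innerSL ℂ (v j))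
    rw [← inner_conj_symm, ← (hasSum_single j fun i hi => hv hi.symm).unique h3,
      inner_self_eq_norm_sq_to_K]
    simp
  rw [inner_self_eq_norm_sq_to_K] at h1
  simp only [h2] at h1
  refine (HasSum.tsum_eq ?_).symm
  have := Complex.hasSum_re h1
  norm_cast at this

end Orthogonal

/-! ### Slices of square integrable functions on a product -/

section Slice

variable {X Y : Type*} [MeasurableSpace X] [MeasurableSpace Y] {μ : Measure X} {ν : Measure Y}

open Classical in
/-- The slice `F(p, ·)`, with value `0` if it is not square integrable. -/
def slice (F : Lp ℂ 2 (μ.prod ν)) (p : X) : Lp ℂ 2 ν :=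
  if h : MemLp (fun y => F (p, y)) 2 ν then h.toLp else 0

theorem slice_eq {F : Lp ℂ 2 (μ.prod ν)} {p : X} {u : Lp ℂ 2 ν}
    (h : (fun y => F (p, y)) =ᵐ[ν] u) : slice F p = u := by
  have hm : MemLp (fun y => F (p, y)) 2 ν := (memLp_congr_ae h).2 (Lp.memLp u)
  rw [slice, dif_pos hm]
  exact Lp.ext (hm.coeFn_toLp.trans h)

theorem memLp_mul_prod {u : X → ℂ} {a : Y → ℂ} (hu : MemLp u 2 μ) (ha : MemLp a 2 ν) :
    MemLp (fun z : X × Y => u z.1 * a z.2) 2 (μ.prod ν) := by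
  have hm : AEStronglyMeasurable (fun z : X × Y => u z.1 * a z.2) (μ.prod ν) :=
    hu.1.comp_fst.mul ha.1.comp_snd
  rw [memLp_two_iff_integrable_sq_norm hm]
  simp only [norm_mul, mul_pow]
  exact ((memLp_two_iff_integrable_sq_norm hu.1).1 hu).mul_prod
    ((memLp_two_iff_integrable_sq_norm ha.1).1 ha)

variable [SFinite ν]

/-- By Tonelli almost every slice has finite L² norm, so the default value 0 in `slice` occurs only
on a null set. -/
theorem coeFn_slice (F : Lp ℂ 2 (μ.prod ν)) :
    ∀ᵐ p ∂μ, slice F p =ᵐ[ν] fun y => F (p, y) := by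
  have hm : Measurable fun z => ‖F z‖ₑ ^ 2 :=
    (Lp.stronglyMeasurable F).measurable.enorm.pow_const 2
  have hfin : ∫⁻ z, ‖F z‖ₑ ^ 2 ∂(μ.prod ν) < ⊤ := by
    rw [← eLpNorm_two_sq]; exact ENNReal.pow_lt_top (Lp.memLp F).2
  rw [lintegral_prod _ hm.aemeasurable] at hfin
  filter_upwards [ae_lt_top hm.lintegral_prod_right' hfin.ne] with p hp
  have h : MemLp (fun y => F (p, y)) 2 ν := by
    refine ⟨((Lp.stronglyMeasurable F).comp_measurable
      measurable_prodMk_left).aestronglyMeasurable, ?_⟩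
    rw [← eLpNorm_two_sq ν fun y => F (p, y)] at hp
    exact lt_of_not_ge fun hle => by simp [top_le_iff.1 hle] at hp
  rw [slice, dif_pos h]
  exact h.coeFn_toLp

/-- A version of `slice_eq` for almost every point. -/
theorem slice_ae_eq {F : Lp ℂ 2 (μ.prod ν)} {u : X → Lp ℂ 2 ν} {Φ : X × Y → ℂ}
    (hF : F =ᵐ[μ.prod ν] Φ) (h : ∀ᵐ p ∂μ, (fun y => Φ (p, y)) =ᵐ[ν] u p) :
    ∀ᵐ p ∂μ, slice F p = u p := by
  filter_upwards [Measure.ae_ae_of_ae_prod hF, h] with p hp hp'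
  exact slice_eq (Filter.EventuallyEq.trans hp hp')

theorem slice_sub (F G : Lp ℂ 2 (μ.prod ν)) :
    ∀ᵐ p ∂μ, slice (F - G) p = slice F p - slice G p := by
  refine slice_ae_eq (Lp.coeFn_sub F G) ?_
  filter_upwards [coeFn_slice F, coeFn_slice G] with p h1 h2
  filter_upwards [h1, h2, Lp.coeFn_sub (slice F p) (slice G p)] with y e1 e2 e3
  rw [e3, Pi.sub_apply, Pi.sub_apply, e1, e2]

theorem eq_of_slice_eq {F G : Lp ℂ 2 (μ.prod ν)} (h : ∀ᵐ p ∂μ, slice F p = slice G p) :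
    F = G := by
  refine Lp.ext ((Measure.ae_prod_iff_ae_ae ?_).2 ?_)
  · exact measurableSet_eq_fun (Lp.stronglyMeasurable F).measurable
      (Lp.stronglyMeasurable G).measurable
  · filter_upwards [h, coeFn_slice F, coeFn_slice G] with p hp h1 h2
    rw [hp] at h1
    exact h1.symm.trans h2

theorem inner_slice (F G : Lp ℂ 2 (μ.prod ν)) :
    ∀ᵐ p ∂μ, inner ℂ (slice F p) (slice G p) = ∫ y, inner ℂ (F (p, y)) (G (p, y)) ∂ν := by
  filter_upwards [coeFn_slice F, coeFn_slice G] with p h1 h2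
  rw [L2.inner_def]
  refine integral_congr_ae ?_
  filter_upwards [h1, h2] with y e1 e2
  rw [e1, e2]

theorem integrable_inner_slice (F G : Lp ℂ 2 (μ.prod ν)) :
    Integrable (fun p => inner ℂ (slice F p) (slice G p)) μ :=
  (L2.integrable_inner (𝕜 := ℂ) F G).integral_prod_left.congr
    ((inner_slice F G).mono fun _ h => h.symm)

theorem integrable_norm_slice_sq (F : Lp ℂ 2 (μ.prod ν)) :
    Integrable (fun p => ‖slice F p‖ ^ 2) μ := by
  have h := (integrable_inner_slice F F).norm
  simpa [inner_self_eq_norm_sq_to_K] using h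

/-- The elementary tensor `(p, y) ↦ u(p) a(y)`. -/
def tensor {u : X → ℂ} (hu : MemLp u 2 μ) (a : Lp ℂ 2 ν) : Lp ℂ 2 (μ.prod ν) :=
  (memLp_mul_prod hu (Lp.memLp a)).toLp

theorem slice_tensor {u : X → ℂ} (hu : MemLp u 2 μ) (a : Lp ℂ 2 ν) :
    ∀ᵐ p ∂μ, slice (tensor hu a) p = u p • a := by
  refine slice_ae_eq (memLp_mul_prod hu (Lp.memLp a)).coeFn_toLp
    (Filter.Eventually.of_forall fun p => ?_)
  filter_upwards [Lp.coeFn_smul (u p) a] with y hy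
  rw [hy, Pi.smul_apply, smul_eq_mul]

/-- Constant fields are square integrable over a finite measure. Facts about pairs of slices thereby
cover pairings with a fixed vector. -/
theorem exists_tensor_slice [IsFiniteMeasure μ] (a : Lp ℂ 2 ν) :
    ∃ F : Lp ℂ 2 (μ.prod ν), ∀ᵐ p ∂μ, slice F p = a :=
  ⟨tensor (memLp_const 1) a, by
    simpa only [one_smul] using slice_tensor (μ := μ) (memLp_const (1 : ℂ)) a⟩

theorem aestronglyMeasurable_inner_slice [IsFiniteMeasure μ] (F : Lp ℂ 2 (μ.prod ν))
    (a : Lp ℂ 2 ν) : AEStronglyMeasurable (fun p => inner ℂ (slice F p) a) μ := by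
  obtain ⟨G, hG⟩ := exists_tensor_slice (μ := μ) a
  refine (integrable_inner_slice F G).1.congr ?_
  filter_upwards [hG] with p hp
  rw [hp]

variable [SFinite μ]

theorem integral_inner_slice (F G : Lp ℂ 2 (μ.prod ν)) :
    ∫ p, inner ℂ (slice F p) (slice G p) ∂μ = inner ℂ F G := by
  rw [integral_congr_ae (inner_slice F G), L2.inner_def]
  exact (integral_prod _ (L2.integrable_inner (𝕜 := ℂ) F G)).symm

theorem integral_norm_slice_sq (F : Lp ℂ 2 (μ.prod ν)) :
    ∫ p, ‖slice F p‖ ^ 2 ∂μ = ‖F‖ ^ 2 := by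
  have h := integral_inner_slice F F
  simp only [inner_self_eq_norm_sq_to_K] at h
  have h' : ∫ p, ((‖slice F p‖ ^ 2 : ℝ) : ℂ) ∂μ = ((‖F‖ ^ 2 : ℝ) : ℂ) := by
    simpa using h
  rw [integral_complex_ofReal] at h'
  exact_mod_cast h'

end Slice

/-! ### Fourier series on the torus -/

section Torus

/-- The representative in `[0,1)` of a point of `ℝ / ℤ`. -/
def unitRep (x : UnitAddCircle) : ℝ := AddCircle.measurableEquivIco 1 0 x

theorem coe_unitRep (x : UnitAddCircle) : (unitRep x : UnitAddCircle) = x :=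
  (AddCircle.equivIco 1 0).symm_apply_apply x

theorem measurable_unitRep : Measurable unitRep :=
  measurable_subtype_coe.comp (AddCircle.measurableEquivIco 1 0).measurable

theorem unitRep_coe {r : ℝ} (hr : r ∈ Set.Ico (0 : ℝ) 1) : unitRep (r : UnitAddCircle) = r := by
  have h := (AddCircle.equivIco (1 : ℝ) 0).apply_symm_apply ⟨r, by simpa using hr⟩
  exact congrArg Subtype.val h

theorem measurePreserving_unitRep :
    MeasurePreserving unitRep AddCircle.haarAddCircle (volume.restrict (Set.Ico (0 : ℝ) 1)) := by
  refine ⟨measurable_unitRep, ?_⟩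
  have hv : (volume : Measure UnitAddCircle) = AddCircle.haarAddCircle := by
    rw [AddCircle.volume_eq_smul_haarAddCircle]; simp
  -- The quotient map preserves measure from a half-open interval (0,1], which agrees with [0,1) up
  -- to a null set; there `unitRep` inverts it.
  rw [← hv, ← (UnitAddCircle.measurePreserving_mk 0).map_eq, zero_add,
    Measure.map_map measurable_unitRep AddCircle.measurable_mk',
    ← restrict_Ico_eq_restrict_Ioc]
  conv_rhs => rw [← Measure.map_id (μ := volume.restrict (Set.Ico (0 : ℝ) 1))]
  refine Measure.map_congr ?_
  filter_upwards [ae_restrict_mem measurableSet_Ico] with r hr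
  exact unitRep_coe hr

/-- The normalised Haar measure on `(ℝ / ℤ)^d`. -/
abbrev haarTorus (d : Type*) [Fintype d] : Measure (UnitAddTorus d) :=
  Measure.pi fun _ => AddCircle.haarAddCircle

theorem torusMeasure_eq (n : ℕ) : torusMeasure n =
    (Measure.pi fun _ : Fin n => volume.restrict (Set.Ico (0 : ℝ) 1)).map (WithLp.toLp 2) := by
  have h : cube n = WithLp.ofLp ⁻¹' (Set.univ.pi fun _ : Fin n => Set.Ico (0 : ℝ) 1) := by
    ext ξ; simp [cube]
  rw [← Measure.restrict_pi_pi, torusMeasure, h]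
  exact ((PiLp.volume_preserving_toLp (Fin n)).restrict_preimage
    (s := WithLp.ofLp ⁻¹' (Set.univ.pi fun _ : Fin n => Set.Ico (0 : ℝ) 1))
    ((MeasurableSet.univ_pi fun _ => measurableSet_Ico).preimage
      (WithLp.measurable_ofLp ..))).map_eq.symm

theorem measurePreserving_cubeRep (n : ℕ) :
    MeasurePreserving (fun x : UnitAddTorus (Fin n) => (WithLp.toLp 2 fun i => unitRep (x i) : Rn n))
      (haarTorus (Fin n)) (torusMeasure n) := by
  have h1 := measurePreserving_pi (fun _ : Fin n => AddCircle.haarAddCircle (T := 1))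
    (fun _ : Fin n => volume.restrict (Set.Ico (0 : ℝ) 1)) fun _ => measurePreserving_unitRep
  have h2 : MeasurePreserving (WithLp.toLp 2 : (Fin n → ℝ) → Rn n)
      (Measure.pi fun _ : Fin n => volume.restrict (Set.Ico (0 : ℝ) 1)) (torusMeasure n) :=
    ⟨WithLp.measurable_toLp .., (torusMeasure_eq n).symm⟩
  exact h2.comp h1

/-- The section `(ℝ / ℤ)^{2n} → [0,1)ⁿ × [0,1)ⁿ`. -/
def cubeRep₂ {n : ℕ} (x : UnitAddTorus (Fin n ⊕ Fin n)) : Rn n × Rn n :=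
  (WithLp.toLp 2 fun i => unitRep (x (Sum.inl i)), WithLp.toLp 2 fun i => unitRep (x (Sum.inr i)))

theorem measurePreserving_cubeRep₂ (n : ℕ) :
    MeasurePreserving (cubeRep₂ (n := n)) (haarTorus (Fin n ⊕ Fin n)) (torusMeasure₂ n) :=
  ((measurePreserving_cubeRep n).prod (measurePreserving_cubeRep n)).comp
    (measurePreserving_sumPiEquivProdPi fun _ : Fin n ⊕ Fin n => AddCircle.haarAddCircle (T := 1))

/-- The character `(ξ, ξ') ↦ e^{2πi(k·ξ + l·ξ')}`. -/
def torusChar {n : ℕ} (k l : Fin n → ℤ) (p : Rn n × Rn n) : ℂ :=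
  Complex.exp ((2 * Real.pi * (inner ℝ (intVec k) p.1 + inner ℝ (intVec l) p.2) : ℝ) * Complex.I)

theorem norm_torusChar {n : ℕ} (k l : Fin n → ℤ) (p : Rn n × Rn n) : ‖torusChar k l p‖ = 1 :=
  Complex.norm_exp_ofReal_mul_I _

theorem continuous_torusChar {n : ℕ} (k l : Fin n → ℤ) : Continuous (torusChar k l) := by
  unfold torusChar
  fun_prop

theorem mFourier_eq {d : Type*} [Fintype d] (m : d → ℤ) (x : UnitAddTorus d) :
    UnitAddTorus.mFourier m x =
      Complex.exp ((2 * Real.pi * ∑ i, m i * unitRep (x i) : ℝ) * Complex.I) := by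
  have h (m : ℤ) (y : UnitAddCircle) :
      fourier m y = Complex.exp ((2 * Real.pi * (m * unitRep y) : ℝ) * Complex.I) := by
    conv_lhs => rw [← coe_unitRep y]
    rw [fourier_coe_apply]
    congr 1
    push_cast
    ring
  simp only [UnitAddTorus.mFourier, ContinuousMap.coe_mk, h, ← Complex.exp_sum, Finset.mul_sum,
    Complex.ofReal_sum, Finset.sum_mul]

theorem inner_intVec {n : ℕ} (k : Fin n → ℤ) (ξ : Rn n) :
    inner ℝ (intVec k) ξ = ∑ i, (k i : ℝ) * ξ i := by
  simp [intVec, PiLp.inner_apply, mul_comm]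

theorem torusChar_cubeRep₂ {n : ℕ} (k l : Fin n → ℤ) (x : UnitAddTorus (Fin n ⊕ Fin n)) :
    torusChar k l (cubeRep₂ x) = UnitAddTorus.mFourier (Sum.elim k l) x := by
  rw [mFourier_eq, torusChar, inner_intVec, inner_intVec, Fintype.sum_sum_type]
  rfl

/-- The `(k, l)`-th Fourier coefficient of `h` on `𝕋ⁿ × 𝕋ⁿ`. -/
def torusCoeff {n : ℕ} (h : Rn n × Rn n → ℂ) (j : (Fin n → ℤ) × (Fin n → ℤ)) : ℂ :=
  ∫ p, conj (torusChar j.1 j.2 p) * h p ∂(torusMeasure₂ n)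

/-- Polarised Parseval on (ℝ/ℤ)^{2n}, transported along the measure preserving section `cubeRep₂`,
under which the characters pull back to the Fourier monomials. -/
theorem hasSum_torusCoeff {n : ℕ} {h h' : Rn n × Rn n → ℂ} (hh : MemLp h 2 (torusMeasure₂ n))
    (hh' : MemLp h' 2 (torusMeasure₂ n)) :
    HasSum (fun j => conj (torusCoeff h j) * torusCoeff h' j)
      (∫ p, conj (h p) * h' p ∂(torusMeasure₂ n)) := by
  have hmp := measurePreserving_cubeRep₂ n
  have key {G : Rn n × Rn n → ℂ} (hG : AEStronglyMeasurable G (torusMeasure₂ n)) :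
      ∫ x, G (cubeRep₂ x) ∂(haarTorus (Fin n ⊕ Fin n)) = ∫ p, G p ∂(torusMeasure₂ n) := by
    rw [← hmp.map_eq] at hG ⊢
    exact (integral_map hmp.measurable.aemeasurable hG).symm
  have coeff {g : Rn n × Rn n → ℂ} (hg : MemLp g 2 (torusMeasure₂ n)) (k l : Fin n → ℤ) :
      UnitAddTorus.mFourierCoeff (hg.comp_measurePreserving hmp).toLp (Sum.elim k l) =
        torusCoeff g (k, l) := by
    refine Eq.trans ?_ (key ((Complex.continuous_conj.comp
      (continuous_torusChar k l)).aestronglyMeasurable.mul hg.1))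
    refine integral_congr_ae ?_
    filter_upwards [(hg.comp_measurePreserving hmp).coeFn_toLp] with x hx
    rw [hx, UnitAddTorus.mFourier_neg, ← torusChar_cubeRep₂, smul_eq_mul]
    rfl
  have hU := hh.comp_measurePreserving hmp
  have hU' := hh'.comp_measurePreserving hmp
  have h1 := UnitAddTorus.hasSum_prod_mFourierCoeff hU.toLp hU'.toLp
  have h2 := key ((Complex.continuous_conj.comp_aestronglyMeasurable hh.1).mul hh'.1)
  have h3 : ∫ x, conj (hU.toLp _ x) * hU'.toLp _ x ∂(haarTorus (Fin n ⊕ Fin n)) =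
      ∫ p, conj (h p) * h' p ∂(torusMeasure₂ n) := by
    refine Eq.trans (integral_congr_ae ?_) h2
    filter_upwards [hU.coeFn_toLp, hU'.coeFn_toLp] with x e1 e2
    rw [e1, e2]
    rfl
  rw [← h3]
  simp only [← coeff hh, ← coeff hh']
  exact (Equiv.sumArrowEquivProdArrow (Fin n) (Fin n) ℤ).symm.hasSum_iff.2 h1

/-- Parseval's identity. -/
theorem hasSum_norm_torusCoeff_sq {n : ℕ} {h : Rn n × Rn n → ℂ}
    (hh : MemLp h 2 (torusMeasure₂ n)) :
    HasSum (fun j => ‖torusCoeff h j‖ ^ 2) (∫ p, ‖h p‖ ^ 2 ∂(torusMeasure₂ n)) := by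
  have h1 := hasSum_torusCoeff hh hh
  simp only [Complex.conj_mul'] at h1
  have h2 : ∫ p, (‖h p‖ : ℂ) ^ 2 ∂(torusMeasure₂ n) =
      ((∫ p, ‖h p‖ ^ 2 ∂(torusMeasure₂ n) : ℝ) : ℂ) := by
    rw [← integral_complex_ofReal]
    simp
  rw [h2] at h1
  exact_mod_cast h1

/-- Orthogonality of the characters. -/
theorem integral_torusChar {n : ℕ} {m : Fin n → ℤ} (hm : m ≠ 0) :
    ∫ ξ, Complex.exp ((2 * Real.pi * inner ℝ (intVec m) ξ : ℝ) * Complex.I) ∂(torusMeasure n)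
      = 0 := by
  rw [← (measurePreserving_cubeRep n).map_eq,
    integral_map (measurePreserving_cubeRep n).measurable.aemeasurable
      (Continuous.aestronglyMeasurable (by fun_prop))]
  have h : inner ℂ (UnitAddTorus.mFourierLp 2 0) (UnitAddTorus.mFourierLp 2 m) = 0 :=
    UnitAddTorus.orthonormal_mFourier.2 hm.symm
  rw [ContinuousMap.inner_toLp, UnitAddTorus.mFourier_zero] at h
  simp only [ContinuousMap.one_apply, map_one, mul_one] at h
  rw [← h]
  refine integral_congr_ae (Filter.Eventually.of_forall fun x => ?_)
  simp only [mFourier_eq, inner_intVec]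

end Torus

/-! ### Weighted composition operators -/

section WeightedComp

variable {α β : Type*} [MeasurableSpace α] [MeasurableSpace β] {μ : Measure α} {ν : Measure β}
  {τ : α → β} {w : α → ℂ}

theorem memLp_weightedComp (hτ : MeasurePreserving τ μ ν) (hw : AEStronglyMeasurable w μ)
    (hw1 : ∀ x, ‖w x‖ = 1) (f : Lp ℂ 2 ν) : MemLp (fun x => w x * f (τ x)) 2 μ := by
  have h := (Lp.memLp f).comp_measurePreserving hτ
  refine h.of_le (hw.mul h.1) (Filter.Eventually.of_forall fun x => ?_)
  rw [norm_mul, hw1, one_mul]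
  rfl

/-- The isometry `f ↦ w · (f ∘ τ)` for a measure preserving `τ` and a unimodular `w`. -/
def weightedComp (hτ : MeasurePreserving τ μ ν) (hw : AEStronglyMeasurable w μ)
    (hw1 : ∀ x, ‖w x‖ = 1) : Lp ℂ 2 ν →ₗᵢ[ℂ] Lp ℂ 2 μ where
  toFun f := (memLp_weightedComp hτ hw hw1 f).toLp
  map_add' f g := by
    rw [← MemLp.toLp_add, MemLp.toLp_eq_toLp_iff]
    filter_upwards [hτ.quasiMeasurePreserving.ae (Lp.coeFn_add f g)] with x hx
    simp only [hx, Pi.add_apply, mul_add]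
  map_smul' c f := by
    rw [RingHom.id_apply, ← MemLp.toLp_const_smul, MemLp.toLp_eq_toLp_iff]
    filter_upwards [hτ.quasiMeasurePreserving.ae (Lp.coeFn_smul c f)] with x hx
    simp only [hx, Pi.smul_apply, smul_eq_mul, mul_left_comm]
  norm_map' f := by
    change ‖(memLp_weightedComp hτ hw hw1 f).toLp‖ = _
    rw [Lp.norm_toLp, Lp.norm_def,
      ← eLpNorm_comp_measurePreserving (Lp.memLp f).1 hτ]
    refine congrArg _ (eLpNorm_congr_norm_ae (Filter.Eventually.of_forall fun x => ?_))
    rw [norm_mul, hw1, one_mul]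
    rfl

theorem coeFn_weightedComp (hτ : MeasurePreserving τ μ ν) (hw : AEStronglyMeasurable w μ)
    (hw1 : ∀ x, ‖w x‖ = 1) (f : Lp ℂ 2 ν) :
    weightedComp hτ hw hw1 f =ᵐ[μ] fun x => w x * f (τ x) :=
  (memLp_weightedComp hτ hw hw1 f).coeFn_toLp

end WeightedComp

/-! ### The kernel of a twisted translate -/

theorem norm_weylKernel {n : ℕ} (f : L2Double n) : ‖weylKernel n f‖ = ‖f‖ := by
  refine (denseRange_integrable n).induction_on
    (p := fun f : L2Double n => ‖weylKernel n f‖ = ‖f‖) f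
    (isClosed_eq (weylKernel n).continuous.norm continuous_norm) fun g => ?_
  rw [weylKernel, LinearMap.extendOfNorm_eq (denseRange_integrable n)
      ⟨1, fun g => by rw [one_mul]; exact (norm_kernelOnIntegrable g).le⟩ g]
  exact norm_kernelOnIntegrable g

theorem measurePreserving_sub_prod {n : ℕ} (a b : Rn n) :
    MeasurePreserving (fun z : Rn n × Rn n => (z.1 - a, z.2 - b)) :=
  (measurePreserving_sub_right volume a).prod (measurePreserving_sub_right volume b)

theorem measurePreserving_add_fst {n : ℕ} (a : Rn n) :
    MeasurePreserving (fun z : Rn n × Rn n => (z.1 + a, z.2)) :=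
  (measurePreserving_add_right volume a).prod (MeasurePreserving.id volume)

/-- The twisted translation as a linear isometry. -/
def twistedTranslationₗᵢ {n : ℕ} (k l : Fin n → ℤ) : L2Double n →ₗᵢ[ℂ] L2Double n :=
  weightedComp (measurePreserving_sub_prod (intVec k) (intVec l))
    (w := fun z => Complex.exp
      ((Real.pi * (inner ℝ z.1 (intVec l) - inner ℝ z.2 (intVec k)) : ℝ) * Complex.I))
    (Continuous.aestronglyMeasurable (by fun_prop)) fun _ => Complex.norm_exp_ofReal_mul_I _

theorem twistedTranslationₗᵢ_apply {n : ℕ} (k l : Fin n → ℤ) (f : L2Double n) :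
    twistedTranslationₗᵢ k l f = twistedTranslation k l f := rfl

/-- The constant `e^{πi k·l}`. -/
def twistPhase {n : ℕ} (k l : Fin n → ℤ) : ℂ :=
  Complex.exp ((Real.pi * inner ℝ (intVec k) (intVec l) : ℝ) * Complex.I)

theorem norm_twistPhase {n : ℕ} (k l : Fin n → ℤ) : ‖twistPhase k l‖ = 1 :=
  Complex.norm_exp_ofReal_mul_I _

/-- The unimodular factor `e^{πi k·l} e^{2πi k·ξ}`. -/
def kernelPhase {n : ℕ} (k l : Fin n → ℤ) (q : Rn n × Rn n) : ℂ :=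
  twistPhase k l * Complex.exp ((2 * Real.pi * inner ℝ (intVec k) q.1 : ℝ) * Complex.I)

/-- Substitute x + k for x: in the exponent the two terms k·η cancel, the two terms k·ξ add up to
2k·ξ, and x·l is absorbed by moving ξ to ξ + l. -/
theorem kernelIntegral_twistedFun {n : ℕ} (k l : Fin n → ℤ) (f : Rn n × Rn n → ℂ)
    (q : Rn n × Rn n) : kernelIntegral (twistedFun k l f) q =
      kernelPhase k l q * kernelIntegral f (q.1 + intVec l, q.2) := by
  rw [kernelIntegral, kernelIntegral, ← integral_const_mul, ← integral_add_right_eq_self _ (intVec k)]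
  congr 1
  ext x
  simp only [twistedFun, kernelPhase, twistPhase, add_sub_cancel_right, sub_sub]
  rw [mul_right_comm, ← Complex.exp_add, mul_left_comm _ (f _), mul_comm _ (f _),
    ← Complex.exp_add, ← Complex.exp_add]
  congr 2
  rw [inner_add_left, inner_add_left, inner_sub_left, inner_add_right, inner_add_right,
    inner_add_right, inner_add_right, real_inner_comm (intVec k) q.1,
    real_inner_comm (intVec k) q.2]
  push_cast
  ring

/-- Both sides are continuous in f, so it suffices to use the integral formula on the dense subspace
L¹ ∩ L². -/
theorem weylKernel_twistedTranslation {n : ℕ} (k l : Fin n → ℤ) (f : L2Double n) :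
    weylKernel n (twistedTranslation k l f) =ᵐ[volume]
      fun q => kernelPhase k l q * weylKernel n f (q.1 + intVec l, q.2) := by
  have hw : AEStronglyMeasurable (kernelPhase k l) (volume : Measure (Rn n × Rn n)) := by
    unfold kernelPhase
    exact Continuous.aestronglyMeasurable (by fun_prop)
  have hw1 (q : Rn n × Rn n) : ‖kernelPhase k l q‖ = 1 := by
    rw [kernelPhase, norm_mul, norm_twistPhase, Complex.norm_exp_ofReal_mul_I, one_mul]
  have hτ := measurePreserving_add_fst (intVec l)
  suffices h : weylKernel n (twistedTranslationₗᵢ k l f) =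
      weightedComp hτ hw hw1 (weylKernel n f) by
    rw [← twistedTranslationₗᵢ_apply, h]
    exact coeFn_weightedComp hτ hw hw1 _
  refine (denseRange_integrable n).induction_on
    (p := fun f : L2Double n => weylKernel n (twistedTranslationₗᵢ k l f) =
      weightedComp hτ hw hw1 (weylKernel n f)) f
    (isClosed_eq ((weylKernel n).continuous.comp (LinearIsometry.continuous _))
      ((LinearIsometry.continuous _).comp (weylKernel n).continuous)) fun g => ?_
  have hg : Integrable (g : L2Double n) := g.2
  have hcoe : twistedTranslation k l (g : L2Double n) =ᵐ[volume] twistedFun k l g :=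
    (memLp_twistedFun k l _).coeFn_toLp
  have hT : Integrable (twistedTranslation k l (g : L2Double n)) := by
    refine Integrable.congr ?_ hcoe.symm
    have h := (measurePreserving_sub_prod (intVec k) (intVec l)).integrable_comp_of_integrable hg
    refine h.bdd_mul (c := 1) (Continuous.aestronglyMeasurable (by fun_prop))
      (Filter.Eventually.of_forall fun z => (Complex.norm_exp_ofReal_mul_I _).le)
  rw [twistedTranslationₗᵢ_apply]
  refine Lp.ext ?_
  -- The translate equals `twistedFun` only almost everywhere; `ae_slice` makes this harmless along
  -- almost every line of integration x ↦ (x, η - ξ).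
  filter_upwards [weylKernel_ae_eq _ hT, coeFn_weightedComp hτ hw hw1 (weylKernel n g),
    hτ.quasiMeasurePreserving.ae (weylKernel_ae_eq _ hg), ae_slice hcoe] with q h1 h2 h3 h4
  refine h1.trans ?_
  refine Eq.trans ?_ h2.symm
  refine Eq.trans ?_ (congrArg _ h3.symm)
  rw [← kernelIntegral_twistedFun, kernelIntegral, kernelIntegral]
  refine integral_congr_ae ?_
  filter_upwards [h4] with x hx
  rw [hx]

/-! ### The Weyl–Zak transform as an isometry -/

/-- The translates of `[0,1)ⁿ` by integer vectors tile `ℝⁿ`. -/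
theorem tsum_lintegral_cube {n : ℕ} (g : Rn n → ℝ≥0∞) :
    ∑' m : Fin n → ℤ, ∫⁻ ξ, g (intVec m + ξ) ∂(torusMeasure n) = ∫⁻ ξ, g ξ := by
  have hc : MeasurableSet (cube n) := by
    have h : cube n = ⋂ i, {ξ : Rn n | ξ i ∈ Set.Ico (0 : ℝ) 1} := by ext; simp [cube]
    rw [h]
    exact MeasurableSet.iInter fun i => measurableSet_Ico.preimage (by fun_prop)
  let tile (m : Fin n → ℤ) : Set (Rn n) := {ξ | ξ - intVec m ∈ cube n}
  have hmem (m : Fin n → ℤ) (ξ : Rn n) : ξ ∈ tile m ↔ ∀ i, m i = ⌊ξ i⌋ := by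
    simp only [tile, cube, intVec, Set.mem_ofPred_eq, PiLp.sub_apply, Set.mem_Ico, sub_nonneg,
      sub_lt_iff_lt_add']
    refine forall_congr' fun i => ?_
    rw [eq_comm, Int.floor_eq_iff]
  have htile (m : Fin n → ℤ) : ∫⁻ ξ, g (intVec m + ξ) ∂(torusMeasure n) = ∫⁻ ξ in tile m, g ξ := by
    rw [torusMeasure, ← (measurePreserving_add_left volume (intVec m)).setLIntegral_comp_preimage_emb
      (MeasurableEquiv.addLeft (intVec m)).measurableEmbedding g (tile m)]
    congr 2
    ext ξ
    simp [tile]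
  have hU : (⋃ m, tile m) = Set.univ := Set.eq_univ_of_forall fun ξ =>
    Set.mem_iUnion.2 ⟨fun i => ⌊ξ i⌋, (hmem _ _).2 fun _ => rfl⟩
  simp only [htile]
  rw [← lintegral_iUnion, hU, Measure.restrict_univ]
  · exact fun m => hc.preimage (by fun_prop)
  · refine fun m m' hne => Set.disjoint_left.2 fun ξ h h' => hne ?_
    ext i
    rw [(hmem _ _).1 h i, (hmem _ _).1 h' i]

/-- The measure on `𝕋ⁿ × 𝕋ⁿ × ℝⁿ`. -/
abbrev zakMeasure (n : ℕ) : Measure ((Rn n × Rn n) × Rn n) :=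
  (torusMeasure₂ n).prod (volume : Measure (Rn n))

/-- The image measure is Lebesgue measure restricted to a single tile. Absolute continuity is enough
to transport almost everywhere identities for the kernel. -/
theorem quasiMeasurePreserving_zakShift {n : ℕ} (m : Fin n → ℤ) :
    Measure.QuasiMeasurePreserving (fun w : (Rn n × Rn n) × Rn n => (intVec m + w.1.1, w.2))
      (zakMeasure n) volume := by
  have hp : MeasurePreserving (fun w : (Rn n × Rn n) × Rn n => (w.1.1, w.2))
      (zakMeasure n) ((torusMeasure n).prod volume) :=
    measurePreserving_fst.prod (MeasurePreserving.id volume)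
  have hmp : MeasurePreserving (fun z : Rn n × Rn n => (intVec m + z.1, z.2)) :=
    (measurePreserving_add_left volume (intVec m)).prod (MeasurePreserving.id volume)
  refine (hmp.quasiMeasurePreserving.mono_left ?_).comp hp.quasiMeasurePreserving
  rw [Measure.volume_eq_prod]
  exact (Measure.prod_mono Measure.restrict_le_self le_rfl).absolutelyContinuous

/-- The `m`-th term of the Weyl–Zak series, as a function of the kernel. -/
def zakTerm {n : ℕ} (m : Fin n → ℤ) : L2Double n →ₗ[ℂ] ZakSpace n where
  toFun K := (memLp_zakTermFun m K).toLp
  map_add' K K' := by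
    rw [← MemLp.toLp_add, MemLp.toLp_eq_toLp_iff]
    filter_upwards [(quasiMeasurePreserving_zakShift m).ae (Lp.coeFn_add K K')] with w hw
    simp only [zakTermFun, hw, Pi.add_apply, add_mul]
  map_smul' c K := by
    rw [RingHom.id_apply, ← MemLp.toLp_const_smul, MemLp.toLp_eq_toLp_iff]
    filter_upwards [(quasiMeasurePreserving_zakShift m).ae (Lp.coeFn_smul c K)] with w hw
    simp only [zakTermFun, hw, Pi.smul_apply, smul_eq_mul, mul_assoc]

theorem coeFn_zakTerm {n : ℕ} (m : Fin n → ℤ) (K : L2Double n) :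
    zakTerm m K =ᵐ[zakMeasure n] zakTermFun m K :=
  (memLp_zakTermFun m K).coeFn_toLp

/-- The exponential is unimodular, and the remaining integrand does not depend on ξ', whose torus
has mass one. -/
theorem enorm_zakTerm_sq {n : ℕ} (m : Fin n → ℤ) (K : L2Double n) :
    ‖zakTerm m K‖ₑ ^ 2 = ∫⁻ ξ, (∫⁻ η, ‖K (intVec m + ξ, η)‖ₑ ^ 2) ∂(torusMeasure n) := by
  have hm : Measurable fun z : Rn n × Rn n => ‖K (intVec m + z.1, z.2)‖ₑ ^ 2 :=
    ((Lp.stronglyMeasurable K).measurable.comp (by fun_prop)).enorm.pow_const 2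
  have hp : MeasurePreserving (fun w : (Rn n × Rn n) × Rn n => (w.1.1, w.2))
      (zakMeasure n) ((torusMeasure n).prod volume) :=
    measurePreserving_fst.prod (MeasurePreserving.id volume)
  rw [Lp.enorm_def, eLpNorm_two_sq]
  calc ∫⁻ w, ‖zakTerm m K w‖ₑ ^ 2 ∂(zakMeasure n)
      = ∫⁻ w, ‖K (intVec m + w.1.1, w.2)‖ₑ ^ 2 ∂(zakMeasure n) := by
        refine lintegral_congr_ae ?_
        filter_upwards [coeFn_zakTerm m K] with w hw
        rw [hw, zakTermFun, enorm_mul, ← ofReal_norm (Complex.exp _),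
          Complex.norm_exp_ofReal_mul_I, ENNReal.ofReal_one, mul_one]
    _ = ∫⁻ z, ‖K (intVec m + z.1, z.2)‖ₑ ^ 2 ∂((torusMeasure n).prod volume) :=
        hp.lintegral_comp hm
    _ = _ := lintegral_prod _ hm.aemeasurable

theorem hasSum_norm_zakTerm_sq {n : ℕ} (K : L2Double n) :
    HasSum (fun m => ‖zakTerm m K‖ ^ 2) (‖K‖ ^ 2) := by
  have hm : Measurable fun z : Rn n × Rn n => ‖K z‖ₑ ^ 2 :=
    (Lp.stronglyMeasurable K).measurable.enorm.pow_const 2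
  have h : ∑' m : Fin n → ℤ, ‖zakTerm m K‖ₑ ^ 2 = ‖K‖ₑ ^ 2 := by
    simp only [enorm_zakTerm_sq]
    rw [tsum_lintegral_cube fun ξ => ∫⁻ η, ‖K (ξ, η)‖ₑ ^ 2, Lp.enorm_def, eLpNorm_two_sq]
    exact (lintegral_prod _ hm.aemeasurable).symm
  have hne : ∑' m : Fin n → ℤ, ‖zakTerm m K‖ₑ ^ 2 ≠ ⊤ := by
    rw [h]; exact ENNReal.pow_ne_top enorm_ne_top
  have h1 := ENNReal.hasSum_toReal hne
  rw [← ENNReal.tsum_toReal_eq fun m => ENNReal.ne_top_of_tsum_ne_top hne m, h] at h1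
  simpa using h1

/-- The variable ξ' enters only through e^{2πi(m - m')·ξ'}, so integrating over it first in (ξ, ξ')
gives zero. -/
theorem inner_zakTerm_eq_zero {n : ℕ} {m m' : Fin n → ℤ} (hne : m ≠ m') (K : L2Double n) :
    inner ℂ (zakTerm m K) (zakTerm m' K) = 0 := by
  have hint := L2.integrable_inner (𝕜 := ℂ) (zakTerm m K) (zakTerm m' K)
  have hae : (fun w => inner ℂ (zakTerm m K w) (zakTerm m' K w)) =ᵐ[zakMeasure n]
      fun w => inner ℂ (K (intVec m + w.1.1, w.2)) (K (intVec m' + w.1.1, w.2)) *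
        Complex.exp ((2 * Real.pi * inner ℝ (intVec (m - m')) w.1.2 : ℝ) * Complex.I) := by
    filter_upwards [coeFn_zakTerm m K, coeFn_zakTerm m' K] with w h1 h2
    rw [h1, h2, zakTermFun, zakTermFun, RCLike.inner_apply, RCLike.inner_apply, map_mul,
      ← Complex.exp_conj, mul_mul_mul_comm, ← Complex.exp_add]
    congr 2
    have : intVec (m - m') = intVec m - intVec m' := by ext; simp [intVec]
    rw [this, inner_sub_left, map_mul, Complex.conj_ofReal, Complex.conj_I]
    push_cast
    ring
  rw [L2.inner_def, integral_congr_ae hae]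
  have hint' := hint.congr hae
  rw [integral_prod _ hint', integral_prod _ hint'.integral_prod_left]
  simp only [integral_mul_const, integral_const_mul, integral_torusChar (sub_ne_zero.2 hne),
    mul_zero, integral_zero]

theorem summable_zakTerm {n : ℕ} (K : L2Double n) : Summable fun m => zakTerm m K :=
  summable_of_pairwise_inner_eq_zero (fun _ _ h => inner_zakTerm_eq_zero h K)
    (hasSum_norm_zakTerm_sq K).summable

theorem weylZak_eq {n : ℕ} (f : L2Double n) :
    weylZak f = ∑' m, zakTerm m (weylKernel n f) := rfl

/-- Pythagoras for the orthogonal terms, whose squared norms add up to ‖K_f‖² by tiling, together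
with Plancherel for the kernel. -/
theorem norm_weylZak {n : ℕ} (f : L2Double n) : ‖weylZak f‖ = ‖f‖ := by
  have h := norm_tsum_sq_of_pairwise_inner_eq_zero (v := fun m => zakTerm m (weylKernel n f))
    (fun _ _ h => inner_zakTerm_eq_zero h _) (hasSum_norm_zakTerm_sq _).summable
  rw [(hasSum_norm_zakTerm_sq (weylKernel n f)).tsum_eq, norm_weylKernel, ← weylZak_eq] at h
  exact (sq_eq_sq₀ (norm_nonneg _) (norm_nonneg _)).1 h

/-- The Weyl–Zak transform as a linear isometry. -/
def weylZakₗᵢ (n : ℕ) : L2Double n →ₗᵢ[ℂ] ZakSpace n where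
  toFun := weylZak
  map_add' f g := by
    simp only [weylZak_eq, map_add]
    exact (summable_zakTerm _).tsum_add (summable_zakTerm _)
  map_smul' c f := by
    simp only [weylZak_eq, map_smul, RingHom.id_apply]
    exact (summable_zakTerm _).tsum_const_smul c
  norm_map' := norm_weylZak

theorem weylZakₗᵢ_apply {n : ℕ} (f : L2Double n) : weylZakₗᵢ n f = weylZak f := rfl

/-- The unimodular factor `e^{πi k·l} e^{2πi(k·ξ + l·ξ')}`. -/
def zakPhase {n : ℕ} (k l : Fin n → ℤ) (p : Rn n × Rn n) : ℂ :=
  twistPhase k l * torusChar k l p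

theorem norm_zakPhase {n : ℕ} (k l : Fin n → ℤ) (p : Rn n × Rn n) : ‖zakPhase k l p‖ = 1 := by
  rw [zakPhase, norm_mul, norm_twistPhase, norm_torusChar, one_mul]

/-- The kernel is shifted by l in ξ; reindexing m to m + l undoes the shift and leaves e^{2πi l·ξ'}.
The factor e^{2πi k·(m + ξ)} reduces to e^{2πi k·ξ} because k·m is an integer. -/
theorem weylZak_twistedTranslation {n : ℕ} (k l : Fin n → ℤ) (f : L2Double n) :
    weylZak (twistedTranslation k l f) =ᵐ[zakMeasure n]
      fun w => zakPhase k l w.1 * weylZak f w := by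
  have hw : AEStronglyMeasurable (fun w : (Rn n × Rn n) × Rn n => zakPhase k l w.1)
      (zakMeasure n) :=
    (continuous_const.mul ((continuous_torusChar k l).comp continuous_fst)).aestronglyMeasurable
  have hid := MeasurePreserving.id (zakMeasure n)
  have hw1 (w : (Rn n × Rn n) × Rn n) : ‖zakPhase k l w.1‖ = 1 := norm_zakPhase k l w.1
  suffices h : weylZak (twistedTranslation k l f) = weightedComp hid hw hw1 (weylZak f) by
    rw [h]
    exact coeFn_weightedComp hid hw hw1 _
  rw [weylZak_eq, weylZak_eq, ← (Equiv.addRight l).tsum_eq fun m => zakTerm m (weylKernel n f)]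
  refine Eq.trans (tsum_congr fun m => ?_)
    ((weightedComp hid hw hw1).toContinuousLinearMap.map_tsum
      ((Equiv.addRight l).summable_iff.2 (summable_zakTerm (weylKernel n f)))).symm
  change zakTerm m (weylKernel n (twistedTranslation k l f)) =
    weightedComp hid hw hw1 (zakTerm (m + l) (weylKernel n f))
  refine Lp.ext (Filter.EventuallyEq.trans ?_ (coeFn_weightedComp hid hw hw1 _).symm)
  filter_upwards [coeFn_zakTerm m (weylKernel n (twistedTranslation k l f)),
    coeFn_zakTerm (m + l) (weylKernel n f),
    (quasiMeasurePreserving_zakShift m).ae (weylKernel_twistedTranslation k l f)] with w h1 h2 h3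
  have e0 : intVec (m + l) = intVec m + intVec l := by ext; simp [intVec]
  have e1 : Complex.exp ((2 * Real.pi * inner ℝ (intVec k) (intVec m) : ℝ) * Complex.I) = 1 := by
    rw [Complex.exp_eq_one_iff]
    refine ⟨∑ i, k i * m i, ?_⟩
    rw [inner_intVec]
    simp only [intVec]
    push_cast
    ring
  rw [h1, zakTermFun, h3]
  refine Eq.trans ?_ (congrArg _ h2.symm)
  rw [zakTermFun, kernelPhase, zakPhase, torusChar, e0, inner_add_right, mul_add,
    Complex.ofReal_add, add_mul, Complex.exp_add, e1, one_mul, add_right_comm]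
  have e2 (a b c d e f : ℂ) (h : b * d = e * f) : a * b * c * d = a * e * (c * f) := by
    linear_combination a * c * h
  refine e2 _ _ _ _ _ _ ?_
  rw [← Complex.exp_add, ← Complex.exp_add, inner_add_left]
  congr 1
  push_cast
  ring

theorem fiber_eq_slice {n : ℕ} (f : L2Double n) (p : Rn n × Rn n) :
    fiber f p = slice (weylZak f) p := rfl

theorem fiber_twistedTranslation {n : ℕ} (k l : Fin n → ℤ) (f : L2Double n) :
    ∀ᵐ p ∂(torusMeasure₂ n),
      fiber (twistedTranslation k l f) p = zakPhase k l p • fiber f p := by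
  refine slice_ae_eq (weylZak_twistedTranslation k l f) ?_
  filter_upwards [coeFn_slice (weylZak f)] with p hp
  filter_upwards [hp, Lp.coeFn_smul (zakPhase k l p) (fiber f p)] with η h1 h2
  rw [h2, Pi.smul_apply, smul_eq_mul, fiber_eq_slice, h1]

/-! ### Fibres of Bessel systems -/

instance secondCountableTopology_L2 (n : ℕ) : SecondCountableTopology (L2 n) := by
  have : Fact ((2 : ℝ≥0∞) ≠ ⊤) := ⟨by norm_num⟩
  have : MeasurableSpace.CountablyGenerated (Rn n) := inferInstance
  have : MeasureTheory.IsSeparable (volume : Measure (Rn n)) := inferInstance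
  exact Lp.SecondCountableTopology

theorem lintegral_enorm_slice_sq {X Y : Type*} [MeasurableSpace X] [MeasurableSpace Y]
    {μ : Measure X} {ν : Measure Y} [SFinite μ] [SFinite ν] (F : Lp ℂ 2 (μ.prod ν)) :
    ∫⁻ p, ‖slice F p‖ₑ ^ 2 ∂μ = ‖F‖ₑ ^ 2 := by
  have h := ofReal_integral_eq_lintegral_ofReal (integrable_norm_slice_sq F)
    (Filter.Eventually.of_forall fun _ => by positivity)
  rw [integral_norm_slice_sq, ENNReal.ofReal_pow (norm_nonneg _), ofReal_norm] at h
  rw [h]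
  simp only [ENNReal.ofReal_pow (norm_nonneg _), ofReal_norm]

/-- Fibres of elements of `V` lie in the range function of `V`. -/
theorem fiber_mem_rangeFunction {n : ℕ} {V : Submodule ℂ (L2Double n)} {f : L2Double n}
    (hf : f ∈ V) : ∀ᵐ p ∂(torusMeasure₂ n), fiber f p ∈ rangeFunction V p := by
  let d (i : ℕ) : L2Double n := TopologicalSpace.denseSeq V i
  have hd (ε : ℝ) (hε : 0 < ε) : ∃ i, ‖f - d i‖ < ε := by
    obtain ⟨i, hi⟩ := Metric.mem_closure_range_iff.1
      (TopologicalSpace.denseRange_denseSeq V ⟨f, hf⟩) ε hε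
    exact ⟨i, by rwa [dist_eq_norm, Submodule.coe_norm, Submodule.coe_sub] at hi⟩
  have hm (i : ℕ) : AEMeasurable (fun p => ‖slice (weylZak f - weylZak (d i)) p‖ₑ ^ 2)
      (torusMeasure₂ n) := by
    have h := (integrable_norm_slice_sq (weylZak f - weylZak (d i))).1.aemeasurable.ennreal_ofReal
    simpa only [ENNReal.ofReal_pow (norm_nonneg _), ofReal_norm] using h
  -- The integral is at most ‖f - d i‖² for every i. Taking the infimum pointwise avoids extracting
  -- an almost everywhere convergent subsequence.
  have hint : ∫⁻ p, ⨅ i, ‖slice (weylZak f - weylZak (d i)) p‖ₑ ^ 2 ∂(torusMeasure₂ n) = 0 := by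
    refine nonpos_iff_eq_zero.1 (ENNReal.le_of_forall_pos_le_add fun ε hε _ => ?_)
    obtain ⟨i, hi⟩ := hd (Real.sqrt ε) (Real.sqrt_pos.2 hε)
    rw [zero_add]
    calc ∫⁻ p, ⨅ i, ‖slice (weylZak f - weylZak (d i)) p‖ₑ ^ 2 ∂(torusMeasure₂ n)
        ≤ ∫⁻ p, ‖slice (weylZak f - weylZak (d i)) p‖ₑ ^ 2 ∂(torusMeasure₂ n) :=
          lintegral_mono fun p => iInf_le _ i
      _ = ‖f - d i‖ₑ ^ 2 := by
          rw [lintegral_enorm_slice_sq, ← weylZakₗᵢ_apply, ← weylZakₗᵢ_apply, ← map_sub,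
            LinearIsometry.enorm_map]
      _ ≤ ε := by
          rw [← ofReal_norm, ← ENNReal.ofReal_pow (norm_nonneg _)]
          refine ENNReal.ofReal_le_of_le_toReal ?_
          rw [ENNReal.coe_toReal, ← Real.sq_sqrt (NNReal.coe_nonneg ε)]
          gcongr
  rw [lintegral_eq_zero_iff' (AEMeasurable.iInf hm)] at hint
  filter_upwards [hint, ae_all_iff.2 fun i => slice_sub (weylZak f) (weylZak (d i))] with p h0 h1
  refine closure_mono Submodule.subset_span (Metric.mem_closure_range_iff.2 fun ε hε => ?_)
  simp only [Pi.zero_apply] at h0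
  have hlt : ⨅ i, ‖slice (weylZak f - weylZak (d i)) p‖ₑ ^ 2 < ENNReal.ofReal (ε ^ 2) := by
    rw [h0]
    exact ENNReal.ofReal_pos.2 (by positivity)
  obtain ⟨i, hi⟩ := iInf_lt_iff.1 hlt
  refine ⟨i, ?_⟩
  rw [h1 i, ← ofReal_norm, ← ENNReal.ofReal_pow (norm_nonneg _),
    ENNReal.ofReal_lt_ofReal_iff (by positivity)] at hi
  rw [dist_eq_norm]
  exact lt_of_pow_lt_pow_left₀ 2 hε.le hi

theorem twistedTranslation_zero {n : ℕ} (f : L2Double n) : twistedTranslation 0 0 f = f := by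
  have h0 : intVec (0 : Fin n → ℤ) = 0 := by ext; simp [intVec]
  refine Lp.ext ((memLp_twistedFun 0 0 f).coeFn_toLp.trans (Filter.Eventually.of_forall fun z => ?_))
  simp [twistedFun, h0]

theorem mem_twistedSpan {n : ℕ} (φ : ℤ → L2Double n) (s : ℤ) : φ s ∈ twistedSpan φ :=
  Submodule.le_topologicalClosure _ (Submodule.subset_span ⟨(0, 0, s), twistedTranslation_zero _⟩)

theorem inner_weylZak {n : ℕ} (f g : L2Double n) :
    inner ℂ (weylZak f) (weylZak g) = inner ℂ f g :=
  (weylZakₗᵢ n).inner_map_map f g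

/-- The inner products with the twisted translates of `g` are Fourier coefficients. -/
theorem inner_weylZak_twistedTranslation {n : ℕ} (k l : Fin n → ℤ) (g : L2Double n)
    (F : ZakSpace n) : inner ℂ (weylZak (twistedTranslation k l g)) F =
      conj (twistPhase k l) * torusCoeff (fun p => inner ℂ (fiber g p) (slice F p)) (k, l) := by
  rw [← integral_inner_slice, torusCoeff, ← integral_const_mul]
  refine integral_congr_ae ?_
  filter_upwards [fiber_twistedTranslation k l g] with p hp
  rw [← fiber_eq_slice, hp, inner_smul_left, zakPhase, map_mul, mul_assoc]

/-- Move U to the other side: its adjoint is a contraction. The bound thus holds on all of the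
target space, so arbitrary tensors u(p) a(η) may serve as test fields. -/
theorem bessel_map_linearIsometry {ι H H' : Type*} [NormedAddCommGroup H] [InnerProductSpace ℂ H]
    [CompleteSpace H] [NormedAddCommGroup H'] [InnerProductSpace ℂ H'] [CompleteSpace H']
    (U : H →ₗᵢ[ℂ] H') {g : ι → H} {B : ℝ} (hB : 0 ≤ B)
    (hg : HasBesselBound g B) :
    HasBesselBound (fun i => U (g i)) B := fun F => by
  have hU : ‖U.toContinuousLinearMap.adjoint F‖ ≤ ‖F‖ := by
    refine (U.toContinuousLinearMap.adjoint.le_opNorm F).trans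
      (mul_le_of_le_one_left (norm_nonneg _) ?_)
    rw [LinearIsometryEquiv.norm_map]
    exact U.norm_toContinuousLinearMap_le
  have e (i : ι) : inner ℂ (U (g i)) F = inner ℂ (g i) (U.toContinuousLinearMap.adjoint F) := by
    rw [ContinuousLinearMap.adjoint_inner_right]
    rfl
  simp only [e]
  obtain ⟨h1, h2⟩ := hg (U.toContinuousLinearMap.adjoint F)
  exact ⟨h1, h2.trans (by gcongr)⟩

variable {n : ℕ} {φ : ℤ → L2Double n} {B : ℝ}

/-- The Bessel property with bound `B`, for the images of the twisted system in the Zak space. -/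
theorem zak_bessel (hB : 0 ≤ B)
    (hφ : HasBesselBound (twistedSystem φ) B) (F : ZakSpace n) :
    Summable (fun x : ((Fin n → ℤ) × (Fin n → ℤ)) × ℤ =>
      ‖torusCoeff (fun p => inner ℂ (fiber (φ x.2) p) (slice F p)) x.1‖ ^ 2) ∧
    ∑' x : ((Fin n → ℤ) × (Fin n → ℤ)) × ℤ,
      ‖torusCoeff (fun p => inner ℂ (fiber (φ x.2) p) (slice F p)) x.1‖ ^ 2 ≤ B * ‖F‖ ^ 2 := by
  have e (x : ((Fin n → ℤ) × (Fin n → ℤ)) × ℤ) :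
      ‖torusCoeff (fun p => inner ℂ (fiber (φ x.2) p) (slice F p)) x.1‖ ^ 2 =
        ‖inner ℂ (weylZakₗᵢ n (twistedSystem φ (Equiv.prodAssoc _ _ _ x))) F‖ ^ 2 := by
    rw [weylZakₗᵢ_apply, twistedSystem, inner_weylZak_twistedTranslation, norm_mul,
      RCLike.norm_conj, norm_twistPhase, one_mul]
    rfl
  obtain ⟨h1, h2⟩ := bessel_map_linearIsometry (weylZakₗᵢ n) hB hφ F
  rw [← (Equiv.prodAssoc _ _ _).summable_iff] at h1
  rw [← (Equiv.prodAssoc _ _ _).tsum_eq] at h2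
  exact ⟨h1.congr fun x => (e x).symm, (tsum_congr e).trans_le h2⟩

/-- Test the Bessel inequality with the field u(p) a, where u is a weight w cut off to E. Parseval
gives ∫_E w² q ≤ ∫_E w² B ‖a‖² for every measurable E, hence the inequality pointwise. -/
theorem ae_sum_inner_fiber_sq_le (hB : 0 ≤ B)
    (hφ : HasBesselBound (twistedSystem φ) B) (A : Finset ℤ) (a : L2 n) :
    ∀ᵐ p ∂(torusMeasure₂ n), ∑ s ∈ A, ‖inner ℂ (fiber (φ s) p) a‖ ^ 2 ≤ B * ‖a‖ ^ 2 := by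
  let q (p : Rn n × Rn n) : ℝ := ∑ s ∈ A, ‖inner ℂ (fiber (φ s) p) a‖ ^ 2
  have hv (s : ℤ) : AEStronglyMeasurable (fun p => inner ℂ (fiber (φ s) p) a) (torusMeasure₂ n) :=
    aestronglyMeasurable_inner_slice (weylZak (φ s)) a
  have hq : AEStronglyMeasurable q (torusMeasure₂ n) :=
    Finset.aestronglyMeasurable_fun_sum _ fun s _ => (hv s).norm.pow 2
  have hq0 (p) : 0 ≤ q p := Finset.sum_nonneg fun s _ => by positivity
  -- With this weight w² and w² q are at most 1, so everything in sight is bounded and Parseval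
  -- applies. Since w is positive, it cancels at the end.
  let w (p : Rn n × Rn n) : ℝ := (Real.sqrt (1 + q p))⁻¹
  have hw : AEStronglyMeasurable w (torusMeasure₂ n) :=
    (Real.continuous_sqrt.measurable.comp_aemeasurable
      (hq.aemeasurable.const_add 1)).inv.aestronglyMeasurable
  have hw2 (p) : w p ^ 2 = (1 + q p)⁻¹ := by
    rw [inv_pow, Real.sq_sqrt (by linarith [hq0 p])]
  have hwpos (p) : 0 < w p ^ 2 := by rw [hw2]; have := hq0 p; positivity
  have hw1 (p) : w p ^ 2 ≤ 1 := by
    rw [hw2]; exact inv_le_one_of_one_le₀ (by linarith [hq0 p])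
  have hwq (p) : w p ^ 2 * q p ≤ 1 := by
    rw [hw2, inv_mul_le_one₀ (by linarith [hq0 p])]; linarith
  have hi1 : Integrable (fun p => w p ^ 2 * q p) (torusMeasure₂ n) :=
    Integrable.of_bound ((hw.pow 2).mul hq) 1 (Filter.Eventually.of_forall fun p => by
      rw [Real.norm_of_nonneg (mul_nonneg (hwpos p).le (hq0 p))]; exact hwq p)
  have hi2 : Integrable (fun p => w p ^ 2 * (B * ‖a‖ ^ 2)) (torusMeasure₂ n) :=
    Integrable.mul_const (Integrable.of_bound (hw.pow 2) 1 (Filter.Eventually.of_forall fun p =>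
      (Real.norm_of_nonneg (hwpos p).le).trans_le (hw1 p))) _
  have key : (fun p => w p ^ 2 * q p) ≤ᵐ[torusMeasure₂ n] fun p => w p ^ 2 * (B * ‖a‖ ^ 2) := by
    refine ae_le_of_forall_setIntegral_le hi1 hi2 fun E hE _ => ?_
    let u : Rn n × Rn n → ℂ := E.indicator fun p => (w p : ℂ)
    have hun (p) : ‖u p‖ ^ 2 = E.indicator (fun p => w p ^ 2) p := by
      by_cases hp : p ∈ E <;> simp [u, hp]
    have hun1 (p) : ‖u p‖ ^ 2 ≤ w p ^ 2 := by
      rw [hun]; exact Set.indicator_le_self' (fun _ _ => (hwpos _).le) _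
    have hum : AEStronglyMeasurable u (torusMeasure₂ n) :=
      (Complex.continuous_ofReal.comp_aestronglyMeasurable hw).indicator hE
    have hu : MemLp u 2 (torusMeasure₂ n) := MemLp.of_bound hum 1
      (Filter.Eventually.of_forall fun p => (sq_le_one_iff₀ (norm_nonneg _)).1
        ((hun1 p).trans (hw1 p)))
    have hF := slice_tensor (ν := (volume : Measure (Rn n))) hu a
    have hc (s : ℤ) (j) : torusCoeff (fun p => inner ℂ (fiber (φ s) p) (slice (tensor hu a) p)) j =
        torusCoeff (fun p => u p * inner ℂ (fiber (φ s) p) a) j := by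
      refine integral_congr_ae ?_
      filter_upwards [hF] with p hp
      rw [hp, inner_smul_right]
    have hs (s : ℤ) (hsA : s ∈ A) :
        MemLp (fun p => u p * inner ℂ (fiber (φ s) p) a) 2 (torusMeasure₂ n) := by
      refine MemLp.of_bound (hum.mul (hv s)) 1 (Filter.Eventually.of_forall fun p => ?_)
      refine (sq_le_one_iff₀ (norm_nonneg _)).1 ?_
      rw [norm_mul, mul_pow]
      refine le_trans ?_ (hwq p)
      exact mul_le_mul (hun1 p) (Finset.single_le_sum (f := fun s =>
        ‖inner ℂ (fiber (φ s) p) a‖ ^ 2) (fun s _ => by positivity) hsA) (by positivity)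
        (hwpos p).le
    have hpars := hasSum_sum fun s hsA => hasSum_norm_torusCoeff_sq (hs s hsA)
    obtain ⟨hb1, hb2⟩ := zak_bessel hB hφ (tensor hu a)
    simp only [hc] at hb1 hb2
    have hle := hasSum_le_of_sum_le hpars fun J => by
      rw [← Finset.sum_product']
      exact (hb1.sum_le_tsum (J ×ˢ A) fun _ _ => by positivity).trans hb2
    have hE1 : ∫ p in E, w p ^ 2 * q p ∂(torusMeasure₂ n) =
        ∑ s ∈ A, ∫ p, ‖u p * inner ℂ (fiber (φ s) p) a‖ ^ 2 ∂(torusMeasure₂ n) := by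
      rw [← integral_finsetSum _ fun s hsA =>
        (memLp_two_iff_integrable_sq_norm (hs s hsA).1).1 (hs s hsA), ← integral_indicator hE]
      congr 1
      ext p
      simp only [norm_mul, mul_pow, ← Finset.mul_sum, hun]
      by_cases hp : p ∈ E <;> simp [hp, q]
    have hE2 : ∫ p in E, w p ^ 2 * (B * ‖a‖ ^ 2) ∂(torusMeasure₂ n) = B * ‖tensor hu a‖ ^ 2 := by
      rw [← integral_norm_slice_sq, ← integral_const_mul, ← integral_indicator hE]
      refine integral_congr_ae ?_
      filter_upwards [hF] with p hp
      rw [hp, norm_smul, mul_pow, hun]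
      by_cases hp : p ∈ E
      · simp only [hp, Set.indicator_of_mem]; ring
      · simp [hp]
    rw [hE1, hE2]
    exact hle
  filter_upwards [key] with p hp
  exact le_of_mul_le_mul_left hp (hwpos p)

/-- The fibres of a Bessel system are Bessel systems with the same bound. -/
theorem ae_bessel_fiber (hB : 0 ≤ B)
    (hφ : HasBesselBound (twistedSystem φ) B) :
    ∀ᵐ p ∂(torusMeasure₂ n), HasBesselBound (fun s => fiber (φ s) p) B := by
  -- Finite subsets of ℤ and a dense sequence form countable families, so one null set serves all.
  -- For finite A both sides are continuous in the vector, which allows the passage to every a.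
  have h : ∀ᵐ p ∂(torusMeasure₂ n), ∀ (A : Finset ℤ) (i : ℕ),
      ∑ s ∈ A, ‖inner ℂ (fiber (φ s) p) (TopologicalSpace.denseSeq (L2 n) i)‖ ^ 2 ≤
        B * ‖TopologicalSpace.denseSeq (L2 n) i‖ ^ 2 :=
    ae_all_iff.2 fun A => ae_all_iff.2 fun i => ae_sum_inner_fiber_sq_le hB hφ A _
  filter_upwards [h] with p hp a
  have hA (A : Finset ℤ) : ∑ s ∈ A, ‖inner ℂ (fiber (φ s) p) a‖ ^ 2 ≤ B * ‖a‖ ^ 2 :=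
    (TopologicalSpace.denseRange_denseSeq (L2 n)).induction_on
      (p := fun a => ∑ s ∈ A, ‖inner ℂ (fiber (φ s) p) a‖ ^ 2 ≤ B * ‖a‖ ^ 2) a
      (isClosed_le (by fun_prop) (by fun_prop)) (hp A)
  have hs := summable_of_sum_le (fun s => by positivity) hA
  exact ⟨hs, hs.tsum_le_of_sum_le hA⟩

/-! ### The frame operator on the fibres -/

/-- Cauchy–Schwarz in ℓ² and the Bessel bound. The sum form provides an integrable majorant when a
and b are slices. -/
theorem HasBesselBound.norm_inner_dualGramian_le {H : Type*} [NormedAddCommGroup H]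
    [InnerProductSpace ℂ H] [CompleteSpace H] {v : ℤ → H} (hB : 0 ≤ B) (hv : HasBesselBound v B)
    (a b : H) : ‖inner ℂ (dualGramian v a) b‖ ≤ B * ‖a‖ ^ 2 + B * ‖b‖ ^ 2 := by
  obtain ⟨C, hC⟩ := exists_isAnalysisOperator hB hv
  have hle (a : H) : ‖C a‖ ^ 2 ≤ B * ‖a‖ ^ 2 := by
    rw [← (hC.norm_sq a).tsum_eq]
    exact (hv a).2
  rw [dualGramian, hC.synthesisOperator_eq, ContinuousLinearMap.adjoint_adjoint,
    ContinuousLinearMap.comp_apply, ContinuousLinearMap.adjoint_inner_left]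
  nlinarith [norm_inner_le_norm (𝕜 := ℂ) (C a) (C b), sq_nonneg (‖C a‖ - ‖C b‖), hle a, hle b,
    sq_nonneg ‖C a‖, sq_nonneg ‖C b‖]

theorem ae_hasSum_inner_dualGramian (hB : 0 ≤ B) (hφ : HasBesselBound (twistedSystem φ) B) :
    ∀ᵐ p ∂(torusMeasure₂ n), ∀ a b : L2 n,
      HasSum (fun s => conj (inner ℂ (fiber (φ s) p) a) * inner ℂ (fiber (φ s) p) b)
        (inner ℂ (dualGramian (fun s => fiber (φ s) p) a) b) := by
  filter_upwards [ae_bessel_fiber hB hφ] with p hp a b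
  obtain ⟨C, hC⟩ := exists_isAnalysisOperator hB hp
  exact hC.inner_dualGramian a b

theorem aestronglyMeasurable_inner_fiber (f : L2Double n) (F : ZakSpace n) :
    AEStronglyMeasurable (fun p => inner ℂ (fiber f p) (slice F p)) (torusMeasure₂ n) :=
  (integrable_inner_slice (weylZak f) F).1

/-- The operators are chosen separately at each p, yet their pairings are almost everywhere limits
of measurable finite sums. -/
theorem aemeasurable_inner_dualGramian (hB : 0 ≤ B) (hφ : HasBesselBound (twistedSystem φ) B)
    (F F' : ZakSpace n) :
    AEMeasurable (fun p => inner ℂ (dualGramian (fun s => fiber (φ s) p) (slice F p)) (slice F' p))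
      (torusMeasure₂ n) := by
  refine aemeasurable_of_tendsto_metrizable_ae Filter.atTop
    (f := fun (A : Finset ℤ) p => ∑ s ∈ A, conj (inner ℂ (fiber (φ s) p) (slice F p)) *
      inner ℂ (fiber (φ s) p) (slice F' p)) (fun A => ?_) ?_
  · exact Finset.aemeasurable_fun_sum _ fun s _ =>
      (Complex.continuous_conj.measurable.comp_aemeasurable
        (aestronglyMeasurable_inner_fiber (φ s) F).aemeasurable).mul
        (aestronglyMeasurable_inner_fiber (φ s) F').aemeasurable
  · filter_upwards [ae_hasSum_inner_dualGramian hB hφ] with p hp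
    exact hp _ _

theorem integrable_inner_dualGramian (hB : 0 ≤ B) (hφ : HasBesselBound (twistedSystem φ) B)
    (F F' : ZakSpace n) :
    Integrable (fun p => inner ℂ (dualGramian (fun s => fiber (φ s) p) (slice F p)) (slice F' p))
      (torusMeasure₂ n) := by
  refine (((integrable_norm_slice_sq F).const_mul B).add
    ((integrable_norm_slice_sq F').const_mul B)).mono'
    (aemeasurable_inner_dualGramian hB hφ F F').aestronglyMeasurable ?_
  filter_upwards [ae_bessel_fiber hB hφ] with p hp
  exact hp.norm_inner_dualGramian_le hB _ _

/-- Pairing two square integrable fields gives only an L¹ function in general. The fibrewise bound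
|⟨𝒥φ_s(p), F(p)⟩|² ≤ B ‖F(p)‖² is what makes Parseval available. -/
theorem memLp_inner_fiber (hB : 0 ≤ B) (hφ : HasBesselBound (twistedSystem φ) B) (s : ℤ)
    (F : ZakSpace n) :
    MemLp (fun p => inner ℂ (fiber (φ s) p) (slice F p)) 2 (torusMeasure₂ n) := by
  have hm := aestronglyMeasurable_inner_fiber (φ s) F
  refine (memLp_two_iff_integrable_sq_norm hm).2
    (((integrable_norm_slice_sq F).const_mul B).mono' (hm.norm.pow 2) ?_)
  filter_upwards [ae_bessel_fiber hB hφ] with p hp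
  rw [Real.norm_of_nonneg (by positivity)]
  exact ((hp (slice F p)).1.le_tsum s fun _ _ => by positivity).trans (hp (slice F p)).2

theorem summable_integral_norm_inner_fiber_sq (hB : 0 ≤ B)
    (hφ : HasBesselBound (twistedSystem φ) B) (F : ZakSpace n) :
    Summable fun s => ∫ p, ‖inner ℂ (fiber (φ s) p) (slice F p)‖ ^ 2 ∂(torusMeasure₂ n) := by
  have h := ((Equiv.prodComm ℤ _).summable_iff.2 (zak_bessel hB hφ F).1).prod
  refine h.congr fun s => ?_
  exact (hasSum_norm_torusCoeff_sq (memLp_inner_fiber hB hφ s F)).tsum_eq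

/-- Parseval's identity for sequences of functions on the torus. -/
theorem integral_tsum_conj_mul {h h' : ℤ → Rn n × Rn n → ℂ}
    (hm : ∀ s, MemLp (h s) 2 (torusMeasure₂ n)) (hm' : ∀ s, MemLp (h' s) 2 (torusMeasure₂ n))
    (hs : Summable fun s => ∫ p, ‖h s p‖ ^ 2 ∂(torusMeasure₂ n))
    (hs' : Summable fun s => ∫ p, ‖h' s p‖ ^ 2 ∂(torusMeasure₂ n)) {z : ℂ}
    (hz : HasSum (fun x : ℤ × ((Fin n → ℤ) × (Fin n → ℤ)) =>
      conj (torusCoeff (h x.1) x.2) * torusCoeff (h' x.1) x.2) z) :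
    ∫ p, ∑' s, conj (h s p) * h' s p ∂(torusMeasure₂ n) = z := by
  have h0 (s : ℤ) : HasSum (fun j => conj (torusCoeff (h s) j) * torusCoeff (h' s) j)
      (∫ p, conj (h s p) * h' s p ∂(torusMeasure₂ n)) := hasSum_torusCoeff (hm s) (hm' s)
  have h1 : HasSum (fun s => ∫ p, conj (h s p) * h' s p ∂(torusMeasure₂ n)) z :=
    HasSum.prod_fiberwise hz h0
  have hi (s : ℤ) : Integrable (fun p => conj (h s p) * h' s p) (torusMeasure₂ n) :=
    (hm s).star.integrable_mul (hm' s)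
  have hsq (s : ℤ) := (memLp_two_iff_integrable_sq_norm (hm s).1).1 (hm s)
  have hsq' (s : ℤ) := (memLp_two_iff_integrable_sq_norm (hm' s).1).1 (hm' s)
  refine (hasSum_integral_of_summable_integral_norm hi ?_).unique h1
  -- The bound |h h'| ≤ |h|² + |h'|² justifies exchanging the sum over s with the integral.
  refine (hs.add hs').of_nonneg_of_le (fun s => integral_nonneg fun p => norm_nonneg _) fun s => ?_
  rw [← integral_add (hsq s) (hsq' s)]
  refine integral_mono (hi s).norm ((hsq s).add (hsq' s)) fun p => ?_
  simp only [norm_mul, RCLike.norm_conj]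
  nlinarith [sq_nonneg (‖h s p‖ - ‖h' s p‖), sq_nonneg ‖h s p‖, sq_nonneg ‖h' s p‖]

/-- Pair the series for S f with F. Each term is a product of two Fourier coefficients, one
conjugated; the phases e^{πi k·l} cancel, and Parseval followed by summation over s recovers the
pairing with G̃. -/
theorem inner_weylZak_frameOperator (hB : 0 ≤ B) (hφ : HasBesselBound (twistedSystem φ) B)
    {S : L2Double n →L[ℂ] L2Double n} (hS : IsFrameOperator (twistedSystem φ) S) (f : L2Double n)
    (F : ZakSpace n) :
    ∫ p, inner ℂ (dualGramian (fun s => fiber (φ s) p) (fiber f p)) (slice F p)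
      ∂(torusMeasure₂ n) = inner ℂ (weylZak (S f)) F := by
  have h1 : HasSum (fun i => weylZak (inner ℂ (twistedSystem φ i) f • twistedSystem φ i))
      (weylZak (S f)) := (hS f).mapL (weylZakₗᵢ n).toContinuousLinearMap
  have h2 : HasSum (fun i => inner ℂ F (weylZak (inner ℂ (twistedSystem φ i) f •
      twistedSystem φ i))) (inner ℂ F (weylZak (S f))) := h1.mapL (innerSL ℂ F)
  have h3 := (((Equiv.prodComm _ _).trans (Equiv.prodAssoc _ _ _)).hasSum_iff.2
    h2).mapL (Complex.conjCLE : ℂ →L[ℝ] ℂ)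
  have e (x : ℤ × ((Fin n → ℤ) × (Fin n → ℤ))) :
      conj (inner ℂ F (weylZak (inner ℂ (twistedTranslation x.2.1 x.2.2 (φ x.1)) f •
        twistedTranslation x.2.1 x.2.2 (φ x.1)))) =
      conj (torusCoeff (fun p => inner ℂ (fiber (φ x.1) p) (slice (weylZak f) p)) x.2) *
        torusCoeff (fun p => inner ℂ (fiber (φ x.1) p) (slice F p)) x.2 := by
    have hp : conj (twistPhase x.2.1 x.2.2) * twistPhase x.2.1 x.2.2 = 1 := by
      rw [Complex.conj_mul', norm_twistPhase]; norm_num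
    rw [inner_conj_symm, ← weylZakₗᵢ_apply, map_smul, weylZakₗᵢ_apply, inner_smul_left,
      ← inner_weylZak, inner_weylZak_twistedTranslation, inner_weylZak_twistedTranslation,
      map_mul, Complex.conj_conj]
    linear_combination (conj (torusCoeff (fun p => inner ℂ (fiber (φ x.1) p)
      (slice (weylZak f) p)) x.2) *
        torusCoeff (fun p => inner ℂ (fiber (φ x.1) p) (slice F p)) x.2) * hp
  have h4 : inner ℂ (weylZak (S f)) F = (Complex.conjCLE : ℂ →L[ℝ] ℂ) (inner ℂ F (weylZak (S f))) :=
    (inner_conj_symm _ _).symm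
  rw [← h4] at h3
  have h5 := integral_tsum_conj_mul (fun s => memLp_inner_fiber hB hφ s (weylZak f))
    (fun s => memLp_inner_fiber hB hφ s F)
    (summable_integral_norm_inner_fiber_sq hB hφ (weylZak f))
    (summable_integral_norm_inner_fiber_sq hB hφ F) (h3.congr_fun fun x => (e x).symm)
  rw [← h5]
  refine integral_congr_ae ?_
  filter_upwards [ae_hasSum_inner_dualGramian hB hφ] with p hp
  exact (hp _ _).tsum_eq.symm

/-- The frame operator acts on the fibres as the dual Gramian. -/
theorem fiber_frameOperator (hB : 0 ≤ B) (hφ : HasBesselBound (twistedSystem φ) B)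
    {S : L2Double n →L[ℂ] L2Double n} (hS : IsFrameOperator (twistedSystem φ) S) (f : L2Double n) :
    ∀ᵐ p ∂(torusMeasure₂ n),
      fiber (S f) p = dualGramian (fun s => fiber (φ s) p) (fiber f p) := by
  have key (b : L2 n) : (fun p => inner ℂ (fiber (S f) p) b) =ᵐ[torusMeasure₂ n]
      fun p => inner ℂ (dualGramian (fun s => fiber (φ s) p) (fiber f p)) b := by
    obtain ⟨F₁, hF₁⟩ := exists_tensor_slice (μ := torusMeasure₂ n) b
    have i1 : Integrable (fun p => inner ℂ (fiber (S f) p) b) (torusMeasure₂ n) := by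
      refine (integrable_inner_slice (weylZak (S f)) F₁).congr ?_
      filter_upwards [hF₁] with p hp
      rw [hp, fiber_eq_slice]
    have i2 : Integrable (fun p => inner ℂ (dualGramian (fun s => fiber (φ s) p) (fiber f p)) b)
        (torusMeasure₂ n) := by
      refine (integrable_inner_dualGramian hB hφ (weylZak f) F₁).congr ?_
      filter_upwards [hF₁] with p hp
      rw [hp, fiber_eq_slice]
    -- Localisation: the integral over E is the global pairing with the tensor of the indicator of E
    -- and b.
    refine i1.ae_eq_of_forall_setIntegral_eq _ _ i2 fun E hE _ => ?_
    have hu : MemLp (E.indicator fun _ => (1 : ℂ)) 2 (torusMeasure₂ n) :=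
      (memLp_const 1).indicator hE
    have hF := slice_tensor (ν := (volume : Measure (Rn n))) hu b
    have e (a : Rn n × Rn n → L2 n) : ∫ p in E, inner ℂ (a p) b ∂(torusMeasure₂ n) =
        ∫ p, inner ℂ (a p) (slice (tensor hu b) p) ∂(torusMeasure₂ n) := by
      rw [← integral_indicator hE]
      refine integral_congr_ae ?_
      filter_upwards [hF] with p hp
      rw [hp]
      by_cases hpE : p ∈ E <;> simp [hpE]
    rw [e, e, inner_weylZak_frameOperator hB hφ hS]
    exact integral_inner_slice (weylZak (S f)) (tensor hu b)
  filter_upwards [ae_all_iff.2 fun i => key (TopologicalSpace.denseSeq (L2 n) i)] with p hp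
  refine ext_inner_right ℂ fun b => ?_
  exact (TopologicalSpace.denseRange_denseSeq (L2 n)).induction_on
    (p := fun b => inner ℂ (fiber (S f) p) b =
      inner ℂ (dualGramian (fun s => fiber (φ s) p) (fiber f p)) b) b
    (isClosed_eq (by fun_prop) (by fun_prop)) hp

theorem IsFrameOperator.mem_topologicalClosure {ι H : Type*} [NormedAddCommGroup H]
    [InnerProductSpace ℂ H] {g : ι → H} {S : H →L[ℂ] H} (hS : IsFrameOperator g S) (f : H) :
    S f ∈ (Submodule.span ℂ (Set.range g)).topologicalClosure :=
  (Submodule.isClosed_topologicalClosure _).mem_of_tendsto (hS f)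
    (Filter.Eventually.of_forall fun _ => Submodule.sum_mem _ fun i _ =>
      Submodule.smul_mem _ _ (Submodule.le_topologicalClosure _ (Submodule.subset_span ⟨i, rfl⟩)))

/-- On fibres a twisted translation is multiplication by a scalar, which the linear map G̃(p)
respects; Z_W is injective. -/
theorem isTwistedShiftPreserving_frameOperator (hB : 0 ≤ B)
    (hφ : HasBesselBound (twistedSystem φ) B)
    {S : L2Double n →L[ℂ] L2Double n} (hS : IsFrameOperator (twistedSystem φ) S) :
    IsTwistedShiftPreserving S := fun k l f => by
  refine (weylZakₗᵢ n).injective (eq_of_slice_eq ?_)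
  filter_upwards [fiber_frameOperator hB hφ hS (twistedTranslation k l f),
    fiber_frameOperator hB hφ hS f, fiber_twistedTranslation k l f,
    fiber_twistedTranslation k l (S f)] with p h1 h2 h3 h4
  rw [weylZakₗᵢ_apply, weylZakₗᵢ_apply, ← fiber_eq_slice, ← fiber_eq_slice, h1, h3, h4, h2, map_smul]

/-! ### Range operators: uniqueness, measurability and association with S -/

/-- Composing with the orthogonal projection extends both operators to L²(ℝⁿ), where agreement on
generators passes to their closed span. -/
theorem rangeFunction_clm_ext {V : Submodule ℂ (L2Double n)} {p : Rn n × Rn n}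
    {R R' : rangeFunction V p →L[ℂ] L2 n}
    (h : ∀ (i : ℕ) (hi : fiber (TopologicalSpace.denseSeq V i : L2Double n) p ∈ rangeFunction V p),
      R ⟨_, hi⟩ = R' ⟨_, hi⟩) : R = R' := by
  let P := (rangeFunction V p).orthogonalProjectionOnto
  have hP (x : rangeFunction V p) : P x = x :=
    Submodule.orthogonalProjectionOnto_mem_subspace_eq_self x
  have hEq : Set.EqOn (R ∘L P) (R' ∘L P)
      (Set.range fun i : ℕ => fiber (TopologicalSpace.denseSeq V i : L2Double n) p) := by
    rintro _ ⟨i, rfl⟩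
    have hi : fiber (TopologicalSpace.denseSeq V i : L2Double n) p ∈ rangeFunction V p :=
      Submodule.le_topologicalClosure _ (Submodule.subset_span ⟨i, rfl⟩)
    have e := hP ⟨_, hi⟩
    simp only [ContinuousLinearMap.comp_apply]
    rw [e]
    exact h i hi
  ext1 x
  have hx := ContinuousLinearMap.eqOn_closure_span hEq x.2
  simp only [ContinuousLinearMap.comp_apply, hP] at hx
  exact hx

/-- The exceptional null set depends on f, but the countable dense sequence defining J already
determines the operator. -/
theorem rangeOperator_unique {V : Submodule ℂ (L2Double n)} {U : L2Double n →L[ℂ] L2Double n}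
    {R R' : RangeOperator V} (hR : R.IsAssociatedTo U) (hR' : R'.IsAssociatedTo U) :
    ∀ᵐ p ∂(torusMeasure₂ n), R' p = R p := by
  filter_upwards [ae_all_iff.2 fun i => hR _ (TopologicalSpace.denseSeq V i).2,
    ae_all_iff.2 fun i => hR' _ (TopologicalSpace.denseSeq V i).2] with p h h'
  refine rangeFunction_clm_ext fun i hi => ?_
  obtain ⟨_, e⟩ := h i
  obtain ⟨_, e'⟩ := h' i
  exact e'.symm.trans e

/-- The dual Gramian, restricted to the range function. -/
def dualGramianRangeOperator (φ : ℤ → L2Double n) : RangeOperator (twistedSpan φ) := fun p =>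
  dualGramian (fun s => fiber (φ s) p) ∘L (rangeFunction (twistedSpan φ) p).subtypeL

/-- Almost everywhere all 𝒥φ_s(p) lie in J(p), so projecting a changes none of the ⟨𝒥φ_s(p), a⟩.
Thus G̃ P = G̃, and measurability of P itself is not needed. -/
theorem isMeasurable_dualGramianRangeOperator (hB : 0 ≤ B)
    (hφ : HasBesselBound (twistedSystem φ) B) :
    (dualGramianRangeOperator φ).IsMeasurable := fun a b => by
  obtain ⟨F, hF⟩ := exists_tensor_slice (μ := torusMeasure₂ n) a
  obtain ⟨F', hF'⟩ := exists_tensor_slice (μ := torusMeasure₂ n) b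
  refine (Complex.continuous_conj.measurable.comp_aemeasurable
    (aemeasurable_inner_dualGramian hB hφ F F')).congr ?_
  filter_upwards [hF, hF', ae_hasSum_inner_dualGramian hB hφ,
    ae_all_iff.2 fun s => fiber_mem_rangeFunction (mem_twistedSpan φ s)] with p h1 h2 h3 h4
  simp only [Function.comp_apply]
  rw [h1, h2, ← inner_conj_symm b]
  congr 1
  refine (h3 a b).unique ?_
  have h5 := h3 ((rangeFunction (twistedSpan φ) p).orthogonalProjectionOnto a) b
  have e (s : ℤ) : inner ℂ (fiber (φ s) p)
      ((rangeFunction (twistedSpan φ) p).orthogonalProjectionOnto a : L2 n) =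
        inner ℂ (fiber (φ s) p) a :=
    Submodule.inner_orthogonalProjectionOnto_eq_of_mem_left ⟨_, h4 s⟩ a
  simp only [e] at h5
  exact h5

theorem isAssociatedTo_dualGramianRangeOperator (hB : 0 ≤ B)
    (hφ : HasBesselBound (twistedSystem φ) B)
    {S : L2Double n →L[ℂ] L2Double n} (hS : IsFrameOperator (twistedSystem φ) S) :
    (dualGramianRangeOperator φ).IsAssociatedTo S := fun f hf => by
  filter_upwards [fiber_mem_rangeFunction hf, fiber_frameOperator hB hφ hS f] with p h1 h2
  exact ⟨h1, h2⟩

end TwistedShift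

end

open MeasureTheory TwistedShift
theorem mainTheorem5 (n : ℕ) (φ : ℤ → L2Double n) (hφ : IsBesselSequence (twistedSystem φ)) :
    ∃ S : L2Double n →L[ℂ] L2Double n,
      IsFrameOperator (twistedSystem φ) S ∧
      IsTwistedShiftPreserving S ∧
      (∀ f, S f ∈ twistedSpan φ) ∧
      (∀ᵐ p ∂(torusMeasure₂ n), IsSynthesisOperator (fun s => fiber (φ s) p)
        (synthesisOperator fun s => fiber (φ s) p)) ∧
      (∀ f, ∀ᵐ p ∂(torusMeasure₂ n),
        fiber (S f) p = dualGramian (fun s => fiber (φ s) p) (fiber f p)) ∧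
      ∃ R : RangeOperator (twistedSpan φ),
        (∀ p, R p = dualGramian (fun s => fiber (φ s) p) ∘L
          (rangeFunction (twistedSpan φ) p).subtypeL) ∧
        R.IsMeasurable ∧ R.IsAssociatedTo S ∧
        ∀ R' : RangeOperator (twistedSpan φ), R'.IsAssociatedTo S →
          ∀ᵐ p ∂(torusMeasure₂ n), R' p = R p := by
  obtain ⟨B, hB0, hφB⟩ := hφ
  have hB := hB0.le
  obtain ⟨C, hC⟩ := exists_isAnalysisOperator hB hφB
  have hS := hC.isFrameOperator
  have hR := isAssociatedTo_dualGramianRangeOperator hB hφB hS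
  refine ⟨_, hS, isTwistedShiftPreserving_frameOperator hB hφB hS, hS.mem_topologicalClosure, ?_,
    fiber_frameOperator hB hφB hS, dualGramianRangeOperator φ, fun _ => rfl,
    isMeasurable_dualGramianRangeOperator hB hφB, hR, fun R' hR' => rangeOperator_unique hR hR'⟩
  filter_upwards [ae_bessel_fiber hB hφB] with p hp
  obtain ⟨C, hC⟩ := exists_isAnalysisOperator hB hp
  exact hC.isSynthesisOperator
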